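/- **Setting.** Let $d\ge 0$ be an integer, $\beta\ge 0$, $h\ne 0$, let $H_0\subset\mathbb R$ be a finite set, and let $P_0$ be a symmetric probability measure on $H_0$ charging every point of $H_0$, with $P_0\neq\delta_0$. Let $\mathbb P=P_0^{\otimes\mathbb Z^d}$ be the law of the random fields $\eta\in H_0^{\mathbb Z^d}$. For spins $\sigma\in\{-1,+1\}^{\mathbb Z^d}$ and finite $\Lambda\subset\mathbb Z^d$ let $$H_\Lambda(\sigma,\eta)=-\beta\sum_{\{x,y\}\cap\Lambda\ne\emptyset,\ |x-y|=1}\sigma_x\sigma_y-h\sum_{x\in\Lambda}\eta_x\sigma_x .$$ Let $\mu^{\pm}_\Lambda[\eta]$ be the Gibbs measure in $\Lambda$ with weights proportional to $e^{-H_\Lambda(\cdot,\eta)}$ and all-$\pm$ boundary condition, let $\mu^\pm[\eta]=\lim_{\Lambda\uparrow\mathbb Z^d}\mu^\pm_\Lambda[\eta]$ (weak limit), and let $K^\pm(d\sigma\,d\eta)=\mathbb P(d\eta)\,\mu^\pm[\eta](d\sigma)$ be the joint measures. Write $\xi=(\sigma,\eta)$ for joint configurations and let $\mathcal F_\Delta$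 be the $\sigma$-algebra generated by $(\xi_x)_{x\in\Delta}$. A *specification* is a family $\gamma=(\gamma_\Lambda)_\Lambda$, $\Lambda\subset\mathbb Z^d$ finite, of $\mathcal F_{\Lambda^c}$-measurable probability kernels with $\gamma_\Lambda(B|\xi)=1_B(\xi)$ for $B\in\mathcal F_{\Lambda^c}$ and $\gamma_{\Lambda'}\gamma_\Lambda=\gamma_{\Lambda'}$ for $\Lambda\subset\Lambda'$, everywhere. It is *nonnull* if, for each nonempty $\Lambda$, the probabilities $\gamma_\Lambda(\zeta_\Lambda|\xi)$ are bounded away from $0$ and $1$ uniformly in $\zeta_\Lambda,\xi$. A probability measure $K$ is *consistent* with $\gamma$, $K\in\mathcal G(\gamma)$, if $K[A|\mathcal F_{\Lambda^c}]=\gamma_\Lambda(A|\cdot)$ $K$-a.s. for all measurable $A$ and finite $\Lambda$; $\mathcal G_{\rm inv}(\gamma)$ is the set of translation-invariant elements of $\mathcal G(\gamma)$. Say that $\gamma$ has *finite range in the spins* if for all finite $\Lambda$ and $A\in\mathcal F_\Lambda$ the function $\gamma_\Lambda(A|\sigma,\eta)$ depends on $\sigma$ only through finitely many spins (the dependence on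 $\eta$ being arbitrary). The specifications $\gamma^{\pm}$ of $K^\pm$ are $$\gamma^\pm_\Lambda(\xi_\Lambda|\xi_{\Lambda^c})=\frac{\mu_\Lambda^{\rm ann,\xi_{\partial\Lambda}}(\xi_\Lambda)}{\int\mu_\Lambda^{\rm ann,\xi_{\partial\Lambda}}(d\tilde\eta_\Lambda)\,Q^\pm_\Lambda(\eta_\Lambda,\tilde\eta_\Lambda,\eta_{\Lambda^c})},\qquad \mu_\Lambda^{\rm ann,\xi_{\partial\Lambda}}(\xi_\Lambda)\propto e^{-H_\Lambda(\sigma,\eta)}\prod_{x\in\Lambda}P_0(\eta_x),$$ $$Q^\pm_\Lambda(\eta^1_\Lambda,\eta^2_\Lambda,\eta_{\Lambda^c})=\int\mu^\pm[\eta^2_\Lambda\eta_{\Lambda^c}](d\sigma)\,e^{-H_\Lambda(\sigma,\eta^1_\Lambda\eta_{\Lambda^c})+H_\Lambda(\sigma,\eta^2_\Lambda\eta_{\Lambda^c})}.$$ The relative entropy density is $h(K|K')=\lim_n|\Lambda_n|^{-1}h_{\Lambda_n}(K|K')$, where $\Lambda_n=[-n,n]^d\cap\mathbb Z^d$ and $h_\Lambda$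 is the relative entropy of the restrictions to $\Lambda$. The *second part of the variational principle* for $(\gamma,K',\mathcal M)$ is: $K\in\mathcal M$ and $h(K|K')=0$ imply $K\in\mathcal G_{\rm inv}(\gamma)$. **Proposition 6.15.** Suppose that the quenched model has a phase transition: for $\mathbb P$-a.e. $\eta$ there is $x\in\mathbb Z^d$ with $\mu^+[\eta](\sigma_x=+)>\mu^-[\eta](\sigma_x=+)$. Then: 1. The limits $\mu^\pm[\eta]$ exist for every $\eta$; $\gamma^+$ and $\gamma^-$ are nonnull translation-invariant specifications with finite range in the spins, and $K^+\in\mathcal G_{\rm inv}(\gamma^+)$, $K^-\in\mathcal G_{\rm inv}(\gamma^-)$. 2. $K^+$ and $K^-$ are not consistent with the same specification: $K^-\notin\mathcal G(\gamma^+)$ and $K^+\notin\mathcal G(\gamma^-)$; moreover, no specification with finite range in the spins is consistent with both $K^+$ and $K^-$. 3. $h(K^+|K^-)=h(K^-|K^+)=0$. Consequently the second part of the variational principle fails for $(\gamma^+,K^+,\mathcal M)$ for every set $\mathcal M$ of translation-invariant probability measures containing $K^-$, and for $(\gamma^-,K^-,\mathcal M)$ for every such $\mathcal M$ containing $K^+$.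 -/

import Mathlib

open MeasureTheory ProbabilityTheory Filter Topology
open scoped ENNReal

noncomputable section

namespace RandomField

/-! ### Configurations on the lattice `ℤ^d` -/

/-- The lattice `ℤ^d`. -/
abbrev Site (d : ℕ) : Type := Fin d → ℤ

/-- Configurations on `ℤ^d` with single-site space `E` (product `σ`-algebra, product topology). -/
abbrev Config (d : ℕ) (E : Type) : Type := Site d → E

/-- The configuration `ζ_Λ ω_{Λᶜ}`. -/
def glue {d : ℕ} {E : Type} (Λ : Finset (Site d)) (ζ : Λ → E) (ω : Config d E) : Config d E :=
  fun x => if hx : x ∈ Λ then ζ ⟨x, hx⟩ else ω x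

/-- The translation `(τ_x ω)(y) = ω(x + y)`. -/
def shift {d : ℕ} {E : Type} (x : Site d) (ω : Config d E) : Config d E := fun y => ω (x + y)

/-- The `σ`-algebra `F_Δ` generated by the coordinates in `Δ`. -/
abbrev sigmaAlg {d : ℕ} {E : Type} [MeasurableSpace E] (Δ : Set (Site d)) :
    MeasurableSpace (Config d E) :=
  cylinderEvents (X := fun _ : Site d => E) Δ

/-- Translation-invariant probability measures. -/
def invariantMeasures (d : ℕ) (E : Type) [MeasurableSpace E] : Set (Measure (Config d E)) :=
  {μ | IsProbabilityMeasure μ ∧ ∀ x, μ.map (shift x) = μ}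

/-! ### Specifications -/

/-- A family of candidates for the finite-volume conditional probabilities:
`γ Λ ω A` is `γ_Λ(A | ω)`. -/
abbrev KernelFamily (d : ℕ) (E : Type) [MeasurableSpace E] : Type :=
  Finset (Site d) → Config d E → Measure (Config d E)

/-- `γ` is a specification: a family of probability kernels from `(Ω, F_{Λᶜ})` to `(Ω, F)` that are
proper and consistent, for every (not just almost every) boundary condition. -/
structure IsSpecification {d : ℕ} {E : Type} [MeasurableSpace E] (γ : KernelFamily d E) :
    Prop where
  isProb : ∀ Λ ω, IsProbabilityMeasure (γ Λ ω)
  measurable : ∀ (Λ : Finset (Site d)) (A : Set (Config d E)), MeasurableSet A →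
    Measurable[sigmaAlg (Λ : Set (Site d))ᶜ] (fun ω => γ Λ ω A)
  proper : ∀ (Λ : Finset (Site d)) (B : Set (Config d E)),
    MeasurableSet[sigmaAlg (Λ : Set (Site d))ᶜ] B → ∀ ω, γ Λ ω B = B.indicator 1 ω
  consistent : ∀ Λ Λ' : Finset (Site d), Λ ⊆ Λ' → ∀ A : Set (Config d E), MeasurableSet A →
    ∀ ω, ∫⁻ ω', γ Λ ω' A ∂(γ Λ' ω) = γ Λ' ω A

/-- `γ` is nonnull: for every (nonempty) finite volume `Λ`, the probabilities `γ_Λ(ζ_Λ | ω)` of the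
configurations in `Λ` are bounded away from `0` and `1`, uniformly in `ζ` and `ω`. -/
def IsNonnull {d : ℕ} {E : Type} [MeasurableSpace E] (γ : KernelFamily d E) : Prop :=
  ∀ Λ : Finset (Site d), Λ.Nonempty → ∃ a b : ℝ, 0 < a ∧ a < b ∧ b < 1 ∧
    ∀ (ζ : Λ → E) (ω : Config d E),
      a ≤ (γ Λ ω).real {ω' | ∀ x : Λ, ω' x = ζ x} ∧
      (γ Λ ω).real {ω' | ∀ x : Λ, ω' x = ζ x} ≤ b

/-- `γ` is translation invariant: `γ_{Λ+x}(A | ω) = γ_Λ(τ_x A | τ_x ω)`. -/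
def IsTranslationInvariant {d : ℕ} {E : Type} [MeasurableSpace E] (γ : KernelFamily d E) : Prop :=
  ∀ (Λ : Finset (Site d)) (x : Site d) (A : Set (Config d E)), MeasurableSet A → ∀ ω,
    γ (Λ.image (fun y => y + x)) ω A = γ Λ (shift x ω) (shift x '' A)

/-- `G(γ)`: the probability measures `μ` consistent with `γ`, that is, such that
`μ[A | F_{Λᶜ}](ω) = γ_Λ(A | ω)` for `μ`-a.e. `ω`, for all `A ∈ F` and all finite `Λ`. -/
def consistentMeasures {d : ℕ} {E : Type} [MeasurableSpace E] (γ : KernelFamily d E) :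
    Set (Measure (Config d E)) :=
  {μ | IsProbabilityMeasure μ ∧
    ∀ (Λ : Finset (Site d)) (A : Set (Config d E)), MeasurableSet A →
      μ⟦A | sigmaAlg (Λ : Set (Site d))ᶜ⟧ =ᵐ[μ] fun ω => (γ Λ ω).real A}

/-- `G_inv(γ)`. -/
def invConsistentMeasures {d : ℕ} {E : Type} [MeasurableSpace E] (γ : KernelFamily d E) :
    Set (Measure (Config d E)) :=
  consistentMeasures γ ∩ invariantMeasures d E

/-! ### Relative entropy density and the variational principle -/

/-- The cube `[-n, n]^d ∩ ℤ^d`. -/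
def cube (d n : ℕ) : Finset (Site d) :=
  Fintype.piFinset fun _ => Finset.Icc (-(n : ℤ)) (n : ℤ)

/-- The finite-volume relative entropy `h_Λ(μ | ν)`: the Kullback–Leibler divergence of the
restrictions of `μ` and `ν` to `Λ` (`∞` without absolute continuity). -/
def finiteRelEntropy {d : ℕ} {E : Type} [MeasurableSpace E] (Λ : Finset (Site d))
    (μ ν : Measure (Config d E)) : ℝ≥0∞ :=
  InformationTheory.klDiv (μ.map (fun ω (x : Λ) => ω x)) (ν.map (fun ω (x : Λ) => ω x))

/-- The relative entropy density `h(μ | ν)` exists and equals `l`. -/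
def HasRelEntropyDensity {d : ℕ} {E : Type} [MeasurableSpace E] (μ ν : Measure (Config d E))
    (l : ℝ≥0∞) : Prop :=
  Tendsto (fun n : ℕ => finiteRelEntropy (cube d n) μ ν / ((cube d n).card : ℝ≥0∞)) atTop (𝓝 l)

/-- The second part of the variational principle for the triple `(γ, ν, M)`:
`h(μ | ν) = 0` and `μ ∈ M` imply `μ ∈ G_inv(γ)`. -/
def SecondPart {d : ℕ} {E : Type} [MeasurableSpace E] (γ : KernelFamily d E)
    (ν : Measure (Config d E)) (M : Set (Measure (Config d E))) : Prop :=
  ∀ μ ∈ M, HasRelEntropyDensity μ ν 0 → μ ∈ invConsistentMeasures γ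

/-! ### The quenched random field Ising model -/

/-- The spin value: `true` is `+1`, `false` is `-1`. -/
def spinVal (s : Bool) : ℝ := if s then 1 else -1

/-- The Hamiltonian `∑_{A ∩ Λ ≠ ∅} Φ_A(σ, η)` of the random field Ising model, where
`Φ_{x,y} = -β σ_x σ_y` for nearest neighbours, `Φ_{x} = -h η_x σ_x`, and `Φ_A = 0` otherwise.
Every nearest-neighbour pair is `{x, x + e_i}` for exactly one `(x, i)`; it meets `Λ` iff `x ∈ Λ` or
`x ∈ Λ - e_i`. -/
def energy {d : ℕ} {H₀ : Finset ℝ} (β h : ℝ) (Λ : Finset (Site d)) (σ : Config d Bool)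
    (η : Config d H₀) : ℝ :=
  (∑ i : Fin d, ∑ x ∈ Λ ∪ Λ.image (fun y => y - Pi.single i 1),
      -(β * spinVal (σ x) * spinVal (σ (x + Pi.single i 1))))
    + ∑ x ∈ Λ, -(h * (η x : ℝ) * spinVal (σ x))

/-- The Boltzmann weight `exp(-H_Λ(τ_Λ σbar_{Λᶜ}, η))`. -/
def boltzmann {d : ℕ} {H₀ : Finset ℝ} (β h : ℝ) (σbar : Config d Bool) (Λ : Finset (Site d))
    (η : Config d H₀) (τ : Λ → Bool) : ℝ :=
  Real.exp (-energy β h Λ (glue Λ τ σbar) η)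

/-- The quenched finite-volume Gibbs measure `μ_Λ^{σbar}[η]`, as a measure. -/
def finiteGibbs {d : ℕ} {H₀ : Finset ℝ} (β h : ℝ) (σbar : Config d Bool) (Λ : Finset (Site d))
    (η : Config d H₀) : Measure (Config d Bool) :=
  ∑ τ : Λ → Bool,
    ENNReal.ofReal (boltzmann β h σbar Λ η τ / ∑ τ' : Λ → Bool, boltzmann β h σbar Λ η τ') •
      Measure.dirac (glue Λ τ σbar)

theorem isProbabilityMeasure_finiteGibbs {d : ℕ} {H₀ : Finset ℝ} (β h : ℝ) (σbar : Config d Bool)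
    (Λ : Finset (Site d)) (η : Config d H₀) :
    IsProbabilityMeasure (finiteGibbs β h σbar Λ η) := by
  have hpos : 0 < ∑ τ' : Λ → Bool, boltzmann β h σbar Λ η τ' :=
    Finset.sum_pos (fun _ _ => Real.exp_pos _) Finset.univ_nonempty
  constructor
  simp only [finiteGibbs, Measure.coe_finsetSum, Finset.sum_apply, Measure.smul_apply,
    measure_univ, smul_eq_mul, mul_one]
  rw [← ENNReal.ofReal_sum_of_nonneg
    (fun τ _ => div_nonneg (show 0 ≤ boltzmann β h σbar Λ η τ from (Real.exp_pos _).le) hpos.le), ← Finset.sum_div,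
    div_self hpos.ne', ENNReal.ofReal_one]

/-- The quenched finite-volume Gibbs measure `μ_Λ^{σbar}[η]`. -/
def quenched {d : ℕ} {H₀ : Finset ℝ} (β h : ℝ) (σbar : Config d Bool) (Λ : Finset (Site d))
    (η : Config d H₀) : ProbabilityMeasure (Config d Bool) :=
  ⟨finiteGibbs β h σbar Λ η, isProbabilityMeasure_finiteGibbs β h σbar Λ η⟩

/-- The quenched infinite-volume state `μ^s[η] = lim_{Λ ↑ ℤ^d} μ_Λ^s[η]` (weak limit along the finite
volumes ordered by inclusion) with all-`+` (`s = true`) or all-`-` (`s = false`) boundary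
condition. -/
def state {d : ℕ} {H₀ : Finset ℝ} (β h : ℝ) (s : Bool) (η : Config d H₀) :
    ProbabilityMeasure (Config d Bool) :=
  limUnder atTop (fun Λ : Finset (Site d) => quenched β h (fun _ => s) Λ η)

/-- The i.i.d. law `ℙ` of the random fields with single-site distribution `P₀`. -/
def disorderLaw (d : ℕ) {H₀ : Finset ℝ} (P₀ : Measure H₀) [IsProbabilityMeasure P₀] :
    Measure (Config d H₀) :=
  Measure.infinitePi (fun _ : Site d => P₀)

/-! ### Joint measures and their conditional probabilities -/

/-- The spins `σ` of a joint configuration `ξ = (σ, η)`. -/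
def spins {d : ℕ} {H₀ : Finset ℝ} (ξ : Config d (Bool × H₀)) : Config d Bool := fun x => (ξ x).1

/-- The random fields `η` of a joint configuration `ξ = (σ, η)`. -/
def fields {d : ℕ} {H₀ : Finset ℝ} (ξ : Config d (Bool × H₀)) : Config d H₀ := fun x => (ξ x).2

/-- The joint measure `K^s(dσ dη) = ℙ(dη) μ^s[η](dσ)`. -/
def jointMeasure {d : ℕ} {H₀ : Finset ℝ} (β h : ℝ) (P₀ : Measure H₀) [IsProbabilityMeasure P₀]
    (s : Bool) : Measure (Config d (Bool × H₀)) :=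
  (disorderLaw d P₀).bind fun η =>
    (state β h s η : Measure (Config d Bool)).map fun σ x => (σ x, η x)

/-- The weight `exp(-H_Λ(σ, η)) ∏_{x ∈ Λ} P₀(η_x)` of the annealed model. -/
def annealedWeight {d : ℕ} {H₀ : Finset ℝ} (β h : ℝ) (P₀ : Measure H₀) (Λ : Finset (Site d))
    (ξ : Config d (Bool × H₀)) : ℝ :=
  Real.exp (-energy β h Λ (spins ξ) (fields ξ)) * ∏ x ∈ Λ, P₀.real {fields ξ x}

/-- The annealed local specification `μ_Λ^{ann, ξ_{∂Λ}}(ζ_Λ)`. -/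
def annealed {d : ℕ} {H₀ : Finset ℝ} (β h : ℝ) (P₀ : Measure H₀) (Λ : Finset (Site d))
    (ζ : Λ → Bool × H₀) (ξ : Config d (Bool × H₀)) : ℝ :=
  annealedWeight β h P₀ Λ (glue Λ ζ ξ) /
    ∑ ζ' : Λ → Bool × H₀, annealedWeight β h P₀ Λ (glue Λ ζ' ξ)

/-- `Q_Λ^s(η¹_Λ, η²_Λ, η_{Λᶜ}) = ∫ μ^s[η²_Λ η_{Λᶜ}](dσ) exp(-(H_Λ(σ, η¹) - H_Λ(σ, η²)))`, where the two
arguments are the full configurations `η¹_Λ η_{Λᶜ}` and `η²_Λ η_{Λᶜ}`. -/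
def Qfun {d : ℕ} {H₀ : Finset ℝ} (β h : ℝ) (s : Bool) (Λ : Finset (Site d))
    (η₁ η₂ : Config d H₀) : ℝ :=
  ∫ σ, Real.exp (-(energy β h Λ σ η₁ - energy β h Λ σ η₂))
    ∂(state β h s η₂ : Measure (Config d Bool))

/-- The density `γ_Λ^s(ζ_Λ | ξ_{Λᶜ})`, equal to
`μ_Λ^ann(ζ_Λ) / ∫ μ_Λ^ann(dη'_Λ) Q_Λ^s(η_Λ, η'_Λ, η_{Λᶜ})`, where `η_Λ` is the field part of `ζ_Λ`. -/
def jointDensity {d : ℕ} {H₀ : Finset ℝ} (β h : ℝ) (P₀ : Measure H₀) (s : Bool)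
    (Λ : Finset (Site d)) (ζ : Λ → Bool × H₀) (ξ : Config d (Bool × H₀)) : ℝ :=
  annealed β h P₀ Λ ζ ξ /
    ∑ ζ' : Λ → Bool × H₀, annealed β h P₀ Λ ζ' ξ *
      Qfun β h s Λ (fields (glue Λ ζ ξ)) (fields (glue Λ ζ' ξ))

/-- The specification `γ^s` of the joint measure `K^s`. -/
def jointSpec {d : ℕ} {H₀ : Finset ℝ} (β h : ℝ) (P₀ : Measure H₀) (s : Bool) :
    KernelFamily d (Bool × H₀) :=
  fun Λ ξ => ∑ ζ : Λ → Bool × H₀,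
    ENNReal.ofReal (jointDensity β h P₀ s Λ ζ ξ) • Measure.dirac (glue Λ ζ ξ)

/-- The kernels have finite range in the spins: for every finite `Λ` and every `A ∈ F_Λ`,
`γ_Λ(A | σ, η)` depends on the spins `σ` only through finitely many of them, while the dependence on
the random fields `η` is arbitrary. -/
def HasFiniteSpinRange {d : ℕ} {H₀ : Finset ℝ} (γ : KernelFamily d (Bool × H₀)) : Prop :=
  ∀ (Λ : Finset (Site d)) (A : Set (Config d (Bool × H₀))),
    MeasurableSet[sigmaAlg (Λ : Set (Site d))] A →
    ∃ Δ : Finset (Site d), ∀ ξ ξ' : Config d (Bool × H₀),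
      fields ξ = fields ξ' → (∀ x ∈ Δ, spins ξ x = spins ξ' x) → γ Λ ξ A = γ Λ ξ' A

end RandomField

end

open RandomField

namespace RandomField

/-! ### Gluing configurations -/

section Glue

variable {d : ℕ} {E : Type}

/-! Everything rests on writing $Q^s_\Lambda(\eta',\eta)$ as a limit of ratios
$Z_V(\eta')/Z_V(\eta)$ of partition functions with boundary condition $s$ (`tendsto_partition_div`).

The states exist by FKG: enlarging the volume lifts a conditioning on spins equal to $s$, so the
probabilities of the events `allEq A s` decrease. These events form a generating π-system, and
compactness does the rest (`tendsto_state`).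

The ratio formula makes $Q$ a cocycle that does not depend on the volume once $\eta$ and $\eta'$
agree off $\Lambda$. Hence $\gamma^s$ is the Gibbs kernel with weights annealed weight over
$Q(\cdot,\text{reference field})$ (`jointSpec_eq_gibbsKernel`). These weights are compatible,
positive, of bounded ratio and translation covariant, so the properties of $\gamma^s$ become general
facts on `gibbsKernel`. Detailed balance of the finite-volume Gibbs measures passes to the states
and then, using independence of the fields, to $K^s$, which is therefore consistent with $\gamma^s$
(`jointMeasure_mem_consistentMeasures`).

Suppose that a kernel of finite range in the spins is shared by $K^+$ and $K^-$. Each state charges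
every spin cylinder, so the almost sure identity with $\gamma^s$ holds for $\mathbb P$-almost every
$\eta$ and all $\sigma$ (`ae_forall_of_ae_jointMeasure`). As $\mathbb P$ is the field marginal of
both measures, $\gamma^+$ and $\gamma^-$ agree on single sites for the same $\eta$, and so do $Q^+$
and $Q^-$. Single-site $Q$ is affine in the probability of a plus spin, with nonzero slope when the
field changes; the phase transition is contradicted (`not_consistent_both`).

Finally, the boundary condition acts through boundary bonds only. On $\Lambda$ the two states, and
hence $K^\pm$, are within a factor $e^{O(|\partial\Lambda|)}$ of each other, uniformly in $\eta$.
This bounds the relative entropy by a boundary term, which vanishes per site on cubes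
(`hasRelEntropyDensity_jointMeasure`). -/

theorem glue_of_mem {Λ : Finset (Site d)} (ζ : Λ → E) (ω : Config d E) {x : Site d} (hx : x ∈ Λ) :
    glue Λ ζ ω x = ζ ⟨x, hx⟩ := dif_pos hx

theorem glue_of_notMem {Λ : Finset (Site d)} (ζ : Λ → E) (ω : Config d E) {x : Site d}
    (hx : x ∉ Λ) : glue Λ ζ ω x = ω x := dif_neg hx

theorem glue_restrict (Λ : Finset (Site d)) (ω : Config d E) :
    glue Λ (fun x : Λ => ω x) ω = ω := by
  funext x
  by_cases hx : x ∈ Λ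
  · rw [glue_of_mem _ _ hx]
  · rw [glue_of_notMem _ _ hx]

theorem glue_eq_self {Λ : Finset (Site d)} {ζ : Λ → E} {ω : Config d E}
    (hζ : ∀ x : Λ, ω x = ζ x) : glue Λ ζ ω = ω := by
  conv_rhs => rw [← glue_restrict Λ ω]
  congr 1
  exact funext fun x => (hζ x).symm

theorem glue_congr {Λ : Finset (Site d)} (ζ : Λ → E) {ω ω' : Config d E}
    (hω : ∀ x ∉ Λ, ω x = ω' x) : glue Λ ζ ω = glue Λ ζ ω' := by
  funext x
  by_cases hx : x ∈ Λ
  · rw [glue_of_mem _ _ hx, glue_of_mem _ _ hx]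
  · rw [glue_of_notMem _ _ hx, glue_of_notMem _ _ hx, hω x hx]

theorem glue_glue (Λ : Finset (Site d)) (ζ ζ' : Λ → E) (ω : Config d E) :
    glue Λ ζ (glue Λ ζ' ω) = glue Λ ζ ω :=
  glue_congr ζ fun _ hx => glue_of_notMem _ _ hx

theorem glue_mem_cylinder (Λ : Finset (Site d)) (ζ : Λ → E) (ω : Config d E) (x : Λ) :
    glue Λ ζ ω x = ζ x := glue_of_mem _ _ x.2

theorem glue_injective (Λ : Finset (Site d)) (ω : Config d E) :
    Function.Injective fun ζ : Λ → E => glue Λ ζ ω := fun ζ ζ' hζ => by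
  funext x
  have := congrFun hζ x
  simpa only [glue_mem_cylinder] using this

theorem glue_comp {F : Type} (f : E → F) (Λ : Finset (Site d)) (ζ : Λ → E) (ω : Config d E) :
    (fun x => f (glue Λ ζ ω x)) = glue Λ (fun x => f (ζ x)) (fun x => f (ω x)) := by
  funext x
  by_cases hx : x ∈ Λ
  · rw [glue_of_mem _ _ hx, glue_of_mem _ _ hx]
  · rw [glue_of_notMem _ _ hx, glue_of_notMem _ _ hx]

theorem continuous_glue [TopologicalSpace E] (Λ : Finset (Site d)) (ζ : Λ → E) :
    Continuous (glue Λ ζ) := by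
  refine continuous_pi fun x => ?_
  by_cases hx : x ∈ Λ
  · simp only [glue_of_mem _ _ hx]; exact continuous_const
  · simp only [glue_of_notMem _ _ hx]; exact continuous_apply x

theorem measurable_glue_sigmaAlg [MeasurableSpace E] (Λ : Finset (Site d)) (ζ : Λ → E) :
    Measurable[sigmaAlg (Λ : Set (Site d))ᶜ] (glue Λ ζ) := by
  refine @measurable_pi_lambda _ _ _ (sigmaAlg (Λ : Set (Site d))ᶜ) _ _ fun x => ?_
  by_cases hx : x ∈ Λ
  · simp only [glue_of_mem _ _ hx]; exact measurable_const
  · simp only [glue_of_notMem _ _ hx]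
    exact measurable_cylinderEvent_apply (X := fun _ : Site d => E) (by simpa using hx)

theorem measurable_glue [MeasurableSpace E] (Λ : Finset (Site d)) (ζ : Λ → E) :
    Measurable (glue Λ ζ) :=
  (measurable_glue_sigmaAlg Λ ζ).mono cylinderEvents_le_pi le_rfl

/-- A measurable function that ignores the coordinates in `Λ` is `F_{Λᶜ}`-measurable. -/
theorem measurable_sigmaAlg_compl [MeasurableSpace E] {F : Type*} [MeasurableSpace F]
    (Λ : Finset (Site d)) (ζ : Λ → E) {f : Config d E → F} (hf : Measurable f)
    (hdep : ∀ ω, f (glue Λ ζ ω) = f ω) : Measurable[sigmaAlg (Λ : Set (Site d))ᶜ] f := by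
  have : f = f ∘ glue Λ ζ := funext fun ω => (hdep ω).symm
  rw [this]
  exact hf.comp (measurable_glue_sigmaAlg Λ ζ)

/-- The sets that do not separate `ω` from `ω'` form a σ-algebra, and it contains the generators of
`sigmaAlg Δ`. -/
theorem mem_iff_of_measurableSet_sigmaAlg [MeasurableSpace E] {Δ : Set (Site d)}
    {B : Set (Config d E)} (hB : MeasurableSet[sigmaAlg Δ] B) {ω ω' : Config d E}
    (hω : ∀ x ∈ Δ, ω x = ω' x) : ω ∈ B ↔ ω' ∈ B := by
  have key : ∀ B : Set (Config d E), MeasurableSet[sigmaAlg Δ] B → (ω ∈ B ↔ ω' ∈ B) := by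
    let m : MeasurableSpace (Config d E) :=
      { MeasurableSet' := fun B => (ω ∈ B ↔ ω' ∈ B)
        measurableSet_empty := by simp
        measurableSet_compl := fun s hs => by simpa using not_congr hs
        measurableSet_iUnion := fun f hf => by simpa using exists_congr hf }
    have hle : sigmaAlg (E := E) Δ ≤ m := by
      refine iSup₂_le fun _ hx => ?_
      rintro _ ⟨t, -, rfl⟩
      change ω _ ∈ t ↔ ω' _ ∈ t
      rw [hω _ hx]
    exact fun B hB => hle B hB
  exact key B hB

theorem measurable_shift [MeasurableSpace E] (x : Site d) :
    Measurable (shift x : Config d E → Config d E) :=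
  measurable_pi_lambda _ fun y => measurable_pi_apply (x + y)

theorem continuous_shift [TopologicalSpace E] (x : Site d) :
    Continuous (shift x : Config d E → Config d E) :=
  continuous_pi fun y => continuous_apply (x + y)

theorem shift_neg_shift (x : Site d) (ω : Config d E) : shift (-x) (shift x ω) = ω := by
  funext y; simp [shift]

theorem shift_shift_neg (x : Site d) (ω : Config d E) : shift x (shift (-x) ω) = ω := by
  funext y; simp [shift]

theorem measurableSet_cylinder [MeasurableSpace E] [MeasurableSingletonClass E]
    (Λ : Finset (Site d)) (ζ : Λ → E) :
    MeasurableSet {ω : Config d E | ∀ x : Λ, ω x = ζ x} := by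
  rw [Set.ofPred_forall]
  exact MeasurableSet.iInter fun x =>
    (measurable_pi_apply (x : Site d) : Measurable fun ω : Config d E => ω x)
      (measurableSet_singleton (ζ x))

theorem measurableSet_sigmaAlg_cylinder [MeasurableSpace E] [MeasurableSingletonClass E]
    (Λ : Finset (Site d)) (ζ : Λ → E) :
    MeasurableSet[sigmaAlg (Λ : Set (Site d))] {ω : Config d E | ∀ x : Λ, ω x = ζ x} := by
  rw [Set.ofPred_forall]
  refine MeasurableSet.iInter fun x => ?_
  exact measurable_cylinderEvent_apply (X := fun _ : Site d => E) x.2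
    (measurableSet_singleton (ζ x))

theorem isClopen_cylinder [TopologicalSpace E] [DiscreteTopology E]
    (Λ : Finset (Site d)) (ζ : Λ → E) :
    IsClopen {ω : Config d E | ∀ x : Λ, ω x = ζ x} := by
  rw [Set.ofPred_forall]
  exact isClopen_iInter_of_finite fun x =>
    (isClopen_discrete ({ζ x} : Set E)).preimage (continuous_apply (x : Site d))

end Glue

/-! ### The energy -/

section Energy

variable {d : ℕ} {H₀ : Finset ℝ} (β h : ℝ)

theorem abs_spinVal (s : Bool) : |spinVal s| = 1 := by cases s <;> simp [spinVal]

/-- The base points `x` of the bonds `{x, x + e_i}` that meet `Λ`. -/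
def bonds (Λ : Finset (Site d)) (i : Fin d) : Finset (Site d) :=
  Λ ∪ Λ.image (fun y => y - Pi.single i 1)

theorem mem_bonds {Λ : Finset (Site d)} {i : Fin d} {x : Site d} :
    x ∈ bonds Λ i ↔ x ∈ Λ ∨ x + Pi.single i 1 ∈ Λ := by
  simp only [bonds, Finset.mem_union, Finset.mem_image]
  refine or_congr Iff.rfl ⟨?_, fun hx => ⟨_, hx, by simp⟩⟩
  rintro ⟨y, hy, rfl⟩
  simpa using hy

theorem bonds_mono {Λ V : Finset (Site d)} (hΛ : Λ ⊆ V) (i : Fin d) : bonds Λ i ⊆ bonds V i :=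
  fun _ hx => mem_bonds.2 ((mem_bonds.1 hx).imp (@hΛ _) (@hΛ _))

theorem energy_eq (Λ : Finset (Site d)) (σ : Config d Bool) (η : Config d H₀) :
    energy β h Λ σ η =
      (∑ i : Fin d, ∑ x ∈ bonds Λ i, -(β * spinVal (σ x) * spinVal (σ (x + Pi.single i 1))))
        + ∑ x ∈ Λ, -(h * (η x : ℝ) * spinVal (σ x)) := rfl

theorem energy_sub_energy_field (Λ : Finset (Site d)) (σ : Config d Bool) (η η' : Config d H₀) :
    energy β h Λ σ η - energy β h Λ σ η' =
      ∑ x ∈ Λ, -(h * ((η x : ℝ) - η' x) * spinVal (σ x)) := by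
  rw [energy_eq, energy_eq, add_sub_add_left_eq_sub, ← Finset.sum_sub_distrib]
  exact Finset.sum_congr rfl fun x _ => by ring

/-- Bonds that miss `Λ` and fields off `Λ` cancel in the difference. This locality is what makes all
weight ratios independent of the volume. -/
theorem energy_sub_energy {Λ V : Finset (Site d)} (hΛ : Λ ⊆ V) {σ σ' : Config d Bool}
    {η η' : Config d H₀} (hσ : ∀ x ∉ Λ, σ x = σ' x) (hη : ∀ x ∉ Λ, η x = η' x) :
    energy β h V σ η - energy β h V σ' η' = energy β h Λ σ η - energy β h Λ σ' η' := by
  simp only [energy_eq, add_sub_add_comm, ← Finset.sum_sub_distrib]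
  congr 1
  · refine Finset.sum_congr rfl fun i _ => ?_
    refine (Finset.sum_subset (bonds_mono hΛ i) fun x _ hx => ?_).symm
    rw [mem_bonds, not_or] at hx
    rw [hσ _ hx.1, hσ _ hx.2, sub_self]
  · refine (Finset.sum_subset hΛ fun x _ hx => ?_).symm
    rw [hσ _ hx, hη _ hx, sub_self]

theorem bonds_image_add (Λ : Finset (Site d)) (x : Site d) (i : Fin d) :
    bonds (Λ.image (fun y => y + x)) i = (bonds Λ i).image (fun y => y + x) := by
  ext y
  simp only [mem_bonds, Finset.mem_image]
  constructor
  · rintro (⟨z, hz, rfl⟩ | ⟨z, hz, hy⟩)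
    · exact ⟨z, Or.inl hz, rfl⟩
    · refine ⟨y - x, Or.inr ?_, by simp⟩
      have : z = y - x + Pi.single i 1 := by
        rw [eq_sub_of_add_eq hy]; abel
      rwa [← this]
  · rintro ⟨z, hz | hz, rfl⟩
    · exact Or.inl ⟨z, hz, rfl⟩
    · exact Or.inr ⟨_, hz, by abel⟩

theorem energy_image_add (Λ : Finset (Site d)) (x : Site d) (σ : Config d Bool)
    (η : Config d H₀) :
    energy β h (Λ.image (fun y => y + x)) σ η = energy β h Λ (shift x σ) (shift x η) := by
  have hinj : Function.Injective fun y : Site d => y + x := add_left_injective x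
  simp only [energy_eq, bonds_image_add]
  congr 1
  · refine Finset.sum_congr rfl fun i _ => ?_
    rw [Finset.sum_image hinj.injOn]
    refine Finset.sum_congr rfl fun y _ => ?_
    simp only [shift]
    rw [add_comm x y, ← add_assoc, add_comm x y, add_right_comm]
  · rw [Finset.sum_image hinj.injOn]
    refine Finset.sum_congr rfl fun y _ => ?_
    simp only [shift, add_comm]

theorem continuous_energy (Λ : Finset (Site d)) (η : Config d H₀) :
    Continuous fun σ : Config d Bool => energy β h Λ σ η := by
  have hs : ∀ x : Site d, Continuous fun σ : Config d Bool => spinVal (σ x) := fun x =>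
    (continuous_of_discreteTopology (f := spinVal)).comp (continuous_apply x)
  simp only [energy_eq]
  refine Continuous.add ?_ ?_
  · exact continuous_finsetSum _ fun i _ => continuous_finsetSum _ fun x _ =>
      ((continuous_const.mul (hs _)).mul (hs _)).neg
  · exact continuous_finsetSum _ fun x _ => (continuous_const.mul (hs _)).neg

theorem measurable_energy {α : Type*} [MeasurableSpace α] (Λ : Finset (Site d))
    {f : α → Config d Bool} {g : α → Config d H₀} (hf : Measurable f) (hg : Measurable g) :
    Measurable fun a => energy β h Λ (f a) (g a) := by
  have hs : ∀ x : Site d, Measurable fun a => spinVal (f a x) := fun x =>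
    (measurable_of_countable spinVal).comp ((measurable_pi_apply x).comp hf)
  have hη : ∀ x : Site d, Measurable fun a => (g a x : ℝ) := fun x =>
    measurable_subtype_coe.comp ((measurable_pi_apply x).comp hg)
  simp only [energy_eq]
  refine Measurable.add ?_ ?_
  · exact Finset.measurable_sum _ fun i _ => Finset.measurable_sum _ fun x _ =>
      ((measurable_const.mul (hs _)).mul (hs _)).neg
  · exact Finset.measurable_sum _ fun x _ => ((measurable_const.mul (hη _)).mul (hs _)).neg

/-- A bound for the absolute values of the random fields. -/
def fieldBound (H₀ : Finset ℝ) : ℝ := ∑ a ∈ H₀, |a|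

theorem abs_field_le (a : H₀) : |(a : ℝ)| ≤ fieldBound H₀ :=
  Finset.single_le_sum (f := fun a : ℝ => |a|) (fun _ _ => abs_nonneg _) a.2

theorem exists_abs_energy_le (Λ : Finset (Site d)) :
    ∃ C : ℝ, ∀ (σ : Config d Bool) (η : Config d H₀), |energy β h Λ σ η| ≤ C := by
  refine ⟨(∑ i : Fin d, ∑ _x ∈ bonds Λ i, |β|) + ∑ _x ∈ Λ, |h| * fieldBound H₀, fun σ η => ?_⟩
  rw [energy_eq]
  refine (abs_add_le _ _).trans (add_le_add ?_ ?_)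
  · refine (Finset.abs_sum_le_sum_abs _ _).trans (Finset.sum_le_sum fun i _ => ?_)
    refine (Finset.abs_sum_le_sum_abs _ _).trans (Finset.sum_le_sum fun x _ => ?_)
    rw [abs_neg, abs_mul, abs_mul, abs_spinVal, abs_spinVal, mul_one, mul_one]
  · refine (Finset.abs_sum_le_sum_abs _ _).trans (Finset.sum_le_sum fun x _ => ?_)
    rw [abs_neg, abs_mul, abs_mul, abs_spinVal, mul_one]
    exact mul_le_mul_of_nonneg_left (abs_field_le _) (abs_nonneg _)

/-- The spins that `energy Λ` depends on. -/
def neighborhood (Λ : Finset (Site d)) : Finset (Site d) :=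
  Λ ∪ Finset.univ.biUnion fun i : Fin d =>
    bonds Λ i ∪ (bonds Λ i).image fun x => x + Pi.single i 1

theorem energy_congr_spins {Λ : Finset (Site d)} {σ σ' : Config d Bool} (η : Config d H₀)
    (hσ : ∀ x ∈ neighborhood Λ, σ x = σ' x) : energy β h Λ σ η = energy β h Λ σ' η := by
  simp only [energy_eq]
  congr 1
  · refine Finset.sum_congr rfl fun i _ => Finset.sum_congr rfl fun x hx => ?_
    rw [hσ x, hσ (x + Pi.single i 1)]
    · exact Finset.mem_union_right _ (Finset.mem_biUnion.2 ⟨i, Finset.mem_univ _,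
        Finset.mem_union_right _ (Finset.mem_image_of_mem _ hx)⟩)
    · exact Finset.mem_union_right _ (Finset.mem_biUnion.2 ⟨i, Finset.mem_univ _,
        Finset.mem_union_left _ hx⟩)
  · exact Finset.sum_congr rfl fun x hx => by rw [hσ x (Finset.mem_union_left _ hx)]

/-- Submodularity is checked bond by bond and uses the ferromagnetic sign of `β`; the field terms
are modular and contribute equality, whatever their sign. This is the lattice condition for FKG. -/
theorem energy_inf_add_energy_sup_le (hβ : 0 ≤ β) (Λ : Finset (Site d)) (σ σ' : Config d Bool)
    (η : Config d H₀) :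
    energy β h Λ (σ ⊓ σ') η + energy β h Λ (σ ⊔ σ') η
      ≤ energy β h Λ σ η + energy β h Λ σ' η := by
  have h1 : ∀ a b c e : Bool, spinVal a * spinVal c + spinVal b * spinVal e ≤
      spinVal (a ⊓ b) * spinVal (c ⊓ e) + spinVal (a ⊔ b) * spinVal (c ⊔ e) := by
    intro a b c e
    cases a <;> cases b <;> cases c <;> cases e <;> norm_num [spinVal]
  have h2 : ∀ a b : Bool, spinVal (a ⊓ b) + spinVal (a ⊔ b) = spinVal a + spinVal b := by
    intro a b
    cases a <;> cases b <;> norm_num [spinVal]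
  have hbond : ∑ i : Fin d, ∑ x ∈ bonds Λ i,
        -(β * spinVal ((σ ⊓ σ') x) * spinVal ((σ ⊓ σ') (x + Pi.single i 1)))
      + ∑ i : Fin d, ∑ x ∈ bonds Λ i,
        -(β * spinVal ((σ ⊔ σ') x) * spinVal ((σ ⊔ σ') (x + Pi.single i 1)))
      ≤ ∑ i : Fin d, ∑ x ∈ bonds Λ i, -(β * spinVal (σ x) * spinVal (σ (x + Pi.single i 1)))
      + ∑ i : Fin d, ∑ x ∈ bonds Λ i,
        -(β * spinVal (σ' x) * spinVal (σ' (x + Pi.single i 1))) := by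
    simp only [← Finset.sum_add_distrib]
    refine Finset.sum_le_sum fun i _ => Finset.sum_le_sum fun x _ => ?_
    have := mul_le_mul_of_nonneg_left
      (h1 (σ x) (σ' x) (σ (x + Pi.single i 1)) (σ' (x + Pi.single i 1))) hβ
    simp only [Pi.inf_apply, Pi.sup_apply]
    linarith
  have hfield : ∑ x ∈ Λ, -(h * (η x : ℝ) * spinVal ((σ ⊓ σ') x))
      + ∑ x ∈ Λ, -(h * (η x : ℝ) * spinVal ((σ ⊔ σ') x))
      = ∑ x ∈ Λ, -(h * (η x : ℝ) * spinVal (σ x))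
      + ∑ x ∈ Λ, -(h * (η x : ℝ) * spinVal (σ' x)) := by
    simp only [← Finset.sum_add_distrib]
    refine Finset.sum_congr rfl fun x _ => ?_
    have := h2 (σ x) (σ' x)
    simp only [Pi.inf_apply, Pi.sup_apply]
    linear_combination -(h * (η x : ℝ)) * this
  simp only [energy_eq]
  linarith

end Energy

end RandomField

namespace RandomField

/-! ### Finite-volume Gibbs sums -/

section FiniteVolume

variable {d : ℕ} {H₀ : Finset ℝ} (β h : ℝ)

open Classical in
/-- The configurations that agree with `ω` off `V`. -/
noncomputable def confs {E : Type} [Fintype E] (V : Finset (Site d)) (ω : Config d E) :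
    Finset (Config d E) :=
  Finset.univ.image fun ζ : V → E => glue V ζ ω

theorem mem_confs {E : Type} [Fintype E] {V : Finset (Site d)} {ω ξ : Config d E} :
    ξ ∈ confs V ω ↔ ∀ x ∉ V, ξ x = ω x := by
  simp only [confs, Finset.mem_image, Finset.mem_univ, true_and]
  constructor
  · rintro ⟨τ, rfl⟩ x hx
    exact glue_of_notMem _ _ hx
  · intro hσ
    exact ⟨fun x => ξ x, by rw [← glue_congr _ hσ, glue_restrict]⟩

theorem sum_confs {E : Type} [Fintype E] {M : Type*} [AddCommMonoid M] (V : Finset (Site d))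
    (ω : Config d E) (f : Config d E → M) :
    ∑ ξ ∈ confs V ω, f ξ = ∑ ζ : V → E, f (glue V ζ ω) := by
  classical
  rw [confs, Finset.sum_image (glue_injective V ω).injOn]

/-- The partition function with boundary condition `σbar`. -/
noncomputable def partition (V : Finset (Site d)) (σbar : Config d Bool) (η : Config d H₀) : ℝ :=
  ∑ σ ∈ confs V σbar, Real.exp (-energy β h V σ η)

theorem partition_pos (V : Finset (Site d)) (σbar : Config d Bool) (η : Config d H₀) :
    0 < partition β h V σbar η :=
  Finset.sum_pos (fun _ _ => Real.exp_pos _) ⟨σbar, mem_confs.2 fun _ _ => rfl⟩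

/-- The measure is a finite sum of point masses, so `f` may be arbitrary. -/
theorem integral_quenched (σbar : Config d Bool) (V : Finset (Site d)) (η : Config d H₀)
    (f : Config d Bool → ℝ) :
    ∫ σ, f σ ∂(quenched β h σbar V η : Measure (Config d Bool)) =
      (∑ σ ∈ confs V σbar, Real.exp (-energy β h V σ η) * f σ) / partition β h V σbar η := by
  change ∫ σ, f σ ∂(finiteGibbs β h σbar V η) = _
  rw [finiteGibbs, integral_finsetSum_measure]
  · rw [sum_confs, Finset.sum_div]
    refine Finset.sum_congr rfl fun τ _ => ?_
    rw [integral_smul_measure, integral_dirac, ENNReal.toReal_ofReal, partition, sum_confs,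
      smul_eq_mul]
    · simp only [boltzmann]; ring
    · exact div_nonneg (Real.exp_pos _).le (Finset.sum_nonneg fun _ _ => (Real.exp_pos _).le)
  · intro τ _
    exact (integrable_dirac (by simp)).smul_measure ENNReal.ofReal_ne_top

/-- The event that all spins in `A` are equal to `s`. -/
def allEq (A : Finset (Site d)) (s : Bool) : Set (Config d Bool) := {σ | ∀ x ∈ A, σ x = s}

theorem isClopen_allEq (A : Finset (Site d)) (s : Bool) : IsClopen (allEq A s) := by
  have : allEq A s = {σ : Config d Bool | ∀ x : A, σ x = (fun _ => s : A → Bool) x} := by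
    ext σ; simp [allEq]
  rw [this]
  exact isClopen_cylinder A _

/-- The indicator of `allEq A s`, as a real function. -/
noncomputable def allEqInd (A : Finset (Site d)) (s : Bool) : Config d Bool → ℝ :=
  (allEq A s).indicator 1

theorem allEqInd_of_mem {A : Finset (Site d)} {s : Bool} {σ : Config d Bool} (hσ : σ ∈ allEq A s) :
    allEqInd A s σ = 1 := Set.indicator_of_mem hσ _

theorem allEqInd_of_notMem {A : Finset (Site d)} {s : Bool} {σ : Config d Bool}
    (hσ : σ ∉ allEq A s) : allEqInd A s σ = 0 := Set.indicator_of_notMem hσ _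

theorem allEqInd_nonneg (A : Finset (Site d)) (s : Bool) (σ : Config d Bool) :
    0 ≤ allEqInd A s σ := Set.indicator_nonneg (fun _ _ => zero_le_one) _

theorem allEqInd_le_of_imp {A : Finset (Site d)} {s : Bool} {σ σ' : Config d Bool}
    (hσ : σ ∈ allEq A s → σ' ∈ allEq A s) : allEqInd A s σ ≤ allEqInd A s σ' := by
  by_cases h1 : σ ∈ allEq A s
  · rw [allEqInd_of_mem h1, allEqInd_of_mem (hσ h1)]
  · rw [allEqInd_of_notMem h1]; exact allEqInd_nonneg _ _ _

theorem glue_inf (V : Finset (Site d)) (τ τ' : V → Bool) (σbar : Config d Bool) :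
    glue V (τ ⊓ τ') σbar = glue V τ σbar ⊓ glue V τ' σbar := by
  funext x
  by_cases hx : x ∈ V
  · simp [glue_of_mem _ _ hx]
  · simp [glue_of_notMem _ _ hx]

theorem glue_sup (V : Finset (Site d)) (τ τ' : V → Bool) (σbar : Config d Bool) :
    glue V (τ ⊔ τ') σbar = glue V τ σbar ⊔ glue V τ' σbar := by
  funext x
  by_cases hx : x ∈ V
  · simp [glue_of_mem _ _ hx]
  · simp [glue_of_notMem _ _ hx]

theorem glue_mono (V : Finset (Site d)) {τ τ' : V → Bool} (hτ : τ ≤ τ') (σbar : Config d Bool) :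
    glue V τ σbar ≤ glue V τ' σbar := by
  intro x
  by_cases hx : x ∈ V
  · simpa [glue_of_mem _ _ hx] using hτ ⟨x, hx⟩
  · simp [glue_of_notMem _ _ hx]

theorem boltzmann_mul_le (hβ : 0 ≤ β) (σbar : Config d Bool) (V : Finset (Site d))
    (η : Config d H₀) (τ τ' : V → Bool) :
    boltzmann β h σbar V η τ * boltzmann β h σbar V η τ' ≤
      boltzmann β h σbar V η (τ ⊓ τ') * boltzmann β h σbar V η (τ ⊔ τ') := by
  simp only [boltzmann, ← Real.exp_add, glue_inf, glue_sup]
  refine Real.exp_le_exp.2 ?_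
  have := energy_inf_add_energy_sup_le β h hβ V (glue V τ σbar) (glue V τ' σbar) η
  linarith

/-- The events `allEq A s` are positively correlated (FKG inequality). -/
theorem sum_allEqInd_mul_le (hβ : 0 ≤ β) (σbar : Config d Bool) (V : Finset (Site d))
    (η : Config d H₀) (A B : Finset (Site d)) (s : Bool) :
    (∑ σ ∈ confs V σbar, Real.exp (-energy β h V σ η) * allEqInd A s σ) *
        ∑ σ ∈ confs V σbar, Real.exp (-energy β h V σ η) * allEqInd B s σ ≤
      partition β h V σbar η * ∑ σ ∈ confs V σbar,
        Real.exp (-energy β h V σ η) * (allEqInd A s σ * allEqInd B s σ) := by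
  simp only [partition, sum_confs]
  cases s
  · have hanti : ∀ A : Finset (Site d),
        Antitone fun τ : V → Bool => allEqInd A false (glue V τ σbar) := by
      intro A τ τ' hτ
      refine allEqInd_le_of_imp fun h1 x hx => ?_
      have := glue_mono V hτ σbar x
      rw [h1 x hx] at this
      exact le_antisymm this (Bool.false_le _)
    -- For minus spins the indicators are decreasing; in the dual order they increase, and the
    -- lattice condition is unchanged because `⊓` and `⊔` only trade places.
    exact fkg (α := (V → Bool)ᵒᵈ)
      (μ := fun τ => boltzmann β h σbar V η (OrderDual.ofDual τ))
      (f := fun τ => allEqInd A false (glue V (OrderDual.ofDual τ) σbar))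
      (g := fun τ => allEqInd B false (glue V (OrderDual.ofDual τ) σbar))
      (fun τ => (Real.exp_pos _).le) (fun τ => allEqInd_nonneg _ _ _)
      (fun τ => allEqInd_nonneg _ _ _) (fun τ τ' hτ => hanti A hτ) (fun τ τ' hτ => hanti B hτ)
      (fun τ τ' => by
        rw [mul_comm (boltzmann β h σbar V η (OrderDual.ofDual (τ ⊓ τ')))]
        exact boltzmann_mul_le β h hβ σbar V η (OrderDual.ofDual τ) (OrderDual.ofDual τ'))
  · have hmono : ∀ A : Finset (Site d),
        Monotone fun τ : V → Bool => allEqInd A true (glue V τ σbar) := by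
      intro A τ τ' hτ
      refine allEqInd_le_of_imp fun h1 x hx => ?_
      have := glue_mono V hτ σbar x
      rw [h1 x hx] at this
      exact le_antisymm (Bool.le_true _) this
    exact fkg (α := V → Bool) (μ := fun τ => boltzmann β h σbar V η τ)
      (f := fun τ => allEqInd A true (glue V τ σbar))
      (g := fun τ => allEqInd B true (glue V τ σbar))
      (fun τ => (Real.exp_pos _).le) (fun τ => allEqInd_nonneg _ _ _)
      (fun τ => allEqInd_nonneg _ _ _) (hmono A) (hmono B)
      (fun τ τ' => boltzmann_mul_le β h hβ σbar V η τ τ')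

/-- Restricting a sum over `V` to the configurations equal to `s` on `V \ Λ` gives the sum
over `Λ`. -/
theorem sum_confs_allEqInd_sdiff {Λ V : Finset (Site d)} (hΛ : Λ ⊆ V) (s : Bool)
    (η : Config d H₀) (f : Config d Bool → ℝ) :
    ∑ σ ∈ confs V (fun _ => s), Real.exp (-energy β h V σ η) * (f σ * allEqInd (V \ Λ) s σ) =
      Real.exp (energy β h Λ (fun _ => s) η - energy β h V (fun _ => s) η) *
        ∑ σ ∈ confs Λ (fun _ => s), Real.exp (-energy β h Λ σ η) * f σ := by
  rw [Finset.mul_sum]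
  have hsub : confs Λ (fun _ => s) ⊆ confs V (fun _ => s) := fun σ hσ =>
    mem_confs.2 fun x hx => mem_confs.1 hσ x fun hx' => hx (hΛ hx')
  rw [← Finset.sum_subset hsub]
  · refine Finset.sum_congr rfl fun σ hσ => ?_
    have hσ' := mem_confs.1 hσ
    rw [allEqInd_of_mem fun x hx => hσ' x (Finset.mem_sdiff.1 hx).2, mul_one, ← mul_assoc,
      ← Real.exp_add]
    congr 2
    have := energy_sub_energy β h hΛ (η := η) (η' := η) hσ' fun _ _ => rfl
    linarith
  · intro σ hσ hσΛ
    rw [allEqInd_of_notMem, mul_zero, mul_zero]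
    refine fun hall => hσΛ (mem_confs.2 fun x hx => ?_)
    by_cases hxV : x ∈ V
    · exact hall x (Finset.mem_sdiff.2 ⟨hxV, hx⟩)
    · exact mem_confs.1 hσ x hxV

/-- The measure in `Λ` is the measure in `V` conditioned on all spins in `V \ Λ` being `s`, and by
FKG this conditioning favours `allEq A s`. -/
theorem integral_allEqInd_quenched_antitone (hβ : 0 ≤ β) (A : Finset (Site d)) (s : Bool)
    (η : Config d H₀) :
    Antitone fun V : Finset (Site d) =>
      ∫ σ, allEqInd A s σ ∂(quenched β h (fun _ => s) V η : Measure (Config d Bool)) := by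
  intro Λ V hΛ
  simp only [integral_quenched]
  have hfkg := sum_allEqInd_mul_le β h hβ (fun _ => s) V η A (V \ Λ) s
  rw [sum_confs_allEqInd_sdiff β h hΛ s η] at hfkg
  have h1 := sum_confs_allEqInd_sdiff β h hΛ s η (fun _ => 1)
  simp only [one_mul, mul_one] at h1
  rw [h1] at hfkg
  rw [div_le_div_iff₀ (partition_pos β h _ _ _) (partition_pos β h _ _ _)]
  have hc := Real.exp_pos (energy β h Λ (fun _ => s) η - energy β h V (fun _ => s) η)
  -- The conditioned sums carry the common factor `exp` of the energy difference at the constant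
  -- configuration `s`; it is cancelled here.
  refine le_of_mul_le_mul_left ?_ hc
  change _ * (_ * partition β h Λ (fun _ => s) η) ≤ _ at hfkg
  linarith

end FiniteVolume

/-! ### The infinite-volume limit -/

section Limit

variable {d : ℕ} {H₀ : Finset ℝ} (β h : ℝ)

theorem isPiSystem_allEq (s : Bool) :
    IsPiSystem (Set.range fun A : Finset (Site d) => allEq A s) := by
  classical
  rintro _ ⟨A, rfl⟩ _ ⟨B, rfl⟩ -
  refine ⟨A ∪ B, ?_⟩
  ext σ
  simp only [allEq, Finset.mem_union, Set.mem_inter_iff, Set.mem_ofPred_eq]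
  exact ⟨fun hσ => ⟨fun x hx => hσ x (Or.inl hx), fun x hx => hσ x (Or.inr hx)⟩,
    fun hσ x hx => hx.elim (hσ.1 x) (hσ.2 x)⟩

/-- A two-valued spin is determined by the event that it equals `s`, so singletons `A` already
generate. -/
theorem generateFrom_allEq (s : Bool) :
    (inferInstance : MeasurableSpace (Config d Bool)) =
      MeasurableSpace.generateFrom (Set.range fun A : Finset (Site d) => allEq A s) := by
  refine le_antisymm ?_ (MeasurableSpace.generateFrom_le ?_)
  · refine iSup_le fun x => ?_
    rw [← measurable_iff_comap_le]
    have hx : MeasurableSet[MeasurableSpace.generateFrom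
        (Set.range fun A : Finset (Site d) => allEq A s)] {σ : Config d Bool | σ x = s} := by
      refine MeasurableSpace.measurableSet_generateFrom ⟨{x}, ?_⟩
      ext σ; simp [allEq]
    refine @measurable_to_bool _
      (MeasurableSpace.generateFrom (Set.range fun A : Finset (Site d) => allEq A s)) _ ?_
    cases s
    · have heq : (fun σ : Config d Bool => σ x) ⁻¹' {true} = {σ | σ x = false}ᶜ := by
        ext σ; simp
      rw [heq]
      exact hx.compl
    · exact hx
  · rintro _ ⟨A, rfl⟩
    exact (isClopen_allEq A s).1.measurableSet

theorem integral_allEqInd (μ : Measure (Config d Bool)) (A : Finset (Site d)) (s : Bool) :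
    ∫ σ, allEqInd A s σ ∂μ = μ.real (allEq A s) :=
  integral_indicator_one (isClopen_allEq A s).1.measurableSet

theorem continuous_allEqInd (A : Finset (Site d)) (s : Bool) : Continuous (allEqInd A s) :=
  continuous_const.indicator fun a ha => by
    rw [(isClopen_allEq A s).frontier_eq] at ha; exact ha.elim

theorem continuous_integral (f : Config d Bool → ℝ) (hf : Continuous f) :
    Continuous fun μ : ProbabilityMeasure (Config d Bool) =>
      ∫ σ, f σ ∂(μ : Measure (Config d Bool)) :=
  ProbabilityMeasure.continuous_integral_continuousMap (⟨f, hf⟩ : C(Config d Bool, ℝ))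

/-- Monotonicity makes the probabilities of `allEq A s` converge, so all cluster points agree on a
generating π-system. The space of probability measures is compact, and a unique cluster point is a
limit. -/
theorem tendsto_state (hβ : 0 ≤ β) (s : Bool) (η : Config d H₀) :
    Tendsto (fun Λ : Finset (Site d) => quenched β h (fun _ => s) Λ η) atTop
      (𝓝 (state β h s η)) := by
  have hconv : ∀ A : Finset (Site d), ∃ l : ℝ, Tendsto (fun V : Finset (Site d) =>
      ∫ σ, allEqInd A s σ ∂(quenched β h (fun _ => s) V η : Measure (Config d Bool)))
      atTop (𝓝 l) := fun A => ⟨_, tendsto_atTop_ciInf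
        (integral_allEqInd_quenched_antitone β h hβ A s η)
        ⟨0, by rintro _ ⟨V, rfl⟩; exact integral_nonneg fun σ => allEqInd_nonneg A s σ⟩⟩
  choose l hl using hconv
  have hcluster : ∀ μ : ProbabilityMeasure (Config d Bool),
      MapClusterPt μ atTop (fun Λ : Finset (Site d) => quenched β h (fun _ => s) Λ η) →
      ∀ A, (μ : Measure (Config d Bool)).real (allEq A s) = l A := by
    intro μ hμ A
    rw [← integral_allEqInd]
    have h1 := hμ.tendsto_comp (continuous_integral _ (continuous_allEqInd A s)).continuousAt
    exact eq_of_nhds_neBot (ClusterPt.mono h1 (hl A))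
  obtain ⟨μ, hμ⟩ := exists_clusterPt_of_compactSpace
    (map (fun Λ : Finset (Site d) => quenched β h (fun _ => s) Λ η) atTop)
  have hlim : Tendsto (fun Λ : Finset (Site d) => quenched β h (fun _ => s) Λ η) atTop (𝓝 μ) := by
    refine le_nhds_of_unique_clusterPt fun ν hν => ?_
    refine ProbabilityMeasure.toMeasure_injective ?_
    refine ext_of_generate_finite _ (generateFrom_allEq s) (isPiSystem_allEq s) ?_ ?_
    · rintro _ ⟨A, rfl⟩
      have := (hcluster ν hν A).trans (hcluster μ hμ A).symm
      exact (measureReal_eq_measureReal_iff).1 this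
    · rw [measure_univ, measure_univ]
  -- `limUnder` is an arbitrary value without convergence; `hlim` is what gives `state` its meaning.
  rw [state, hlim.limUnder_eq]
  exact hlim

theorem tendsto_integral_state (hβ : 0 ≤ β) (s : Bool) (η : Config d H₀) {f : Config d Bool → ℝ}
    (hf : Continuous f) :
    Tendsto (fun Λ : Finset (Site d) =>
      ∫ σ, f σ ∂(quenched β h (fun _ => s) Λ η : Measure (Config d Bool))) atTop
      (𝓝 (∫ σ, f σ ∂(state β h s η : Measure (Config d Bool)))) :=
  ((continuous_integral f hf).tendsto _).comp (tendsto_state β h hβ s η)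

end Limit

end RandomField

namespace RandomField

/-! ### Detailed balance for the quenched states -/

/-- The cylinder event `{ω_Λ = ζ}`. -/
abbrev cyl {d : ℕ} {E : Type} (Λ : Finset (Site d)) (ζ : Λ → E) : Set (Config d E) :=
  {ω | ∀ x : Λ, ω x = ζ x}

theorem glue_mem_cyl {d : ℕ} {E : Type} (Λ : Finset (Site d)) (ζ : Λ → E) (ω : Config d E) :
    glue Λ ζ ω ∈ cyl Λ ζ := glue_mem_cylinder Λ ζ ω

theorem mem_cyl_restrict {d : ℕ} {E : Type} (Λ : Finset (Site d)) (ω : Config d E) :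
    ω ∈ cyl Λ (fun x : Λ => ω x) := fun _ => rfl

theorem mem_cyl_iff {d : ℕ} {E : Type} {Λ : Finset (Site d)} {ζ : Λ → E} {ω : Config d E} :
    ω ∈ cyl Λ ζ ↔ (fun x : Λ => ω x) = ζ := funext_iff.symm

section DetailedBalance

variable {d : ℕ} {H₀ : Finset ℝ} (β h : ℝ)

/-- Overwriting the spins in `Λ` is a bijection between the configurations equal to `τ'` and those
equal to `τ` there. -/
theorem sum_cyl_glue {Λ V : Finset (Site d)} (hΛ : Λ ⊆ V) (σbar : Config d Bool)
    (τ τ' : Λ → Bool) (Φ : Config d Bool → ℝ) :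
    ∑ σ ∈ confs V σbar, (cyl Λ τ').indicator (fun σ => Φ (glue Λ τ σ)) σ =
      ∑ σ ∈ confs V σbar, (cyl Λ τ).indicator Φ σ := by
  classical
  have hmem : ∀ (τ : Λ → Bool) {σ : Config d Bool}, σ ∈ confs V σbar →
      glue Λ τ σ ∈ confs V σbar := fun τ σ hσ => mem_confs.2 fun x hx => by
    rw [glue_of_notMem _ _ fun h' => hx (hΛ h'), mem_confs.1 hσ x hx]
  simp only [Set.indicator_apply, ← Finset.sum_filter]
  refine Finset.sum_bij' (fun σ _ => glue Λ τ σ) (fun σ _ => glue Λ τ' σ) ?_ ?_ ?_ ?_ ?_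
  · intro σ hσ
    exact Finset.mem_filter.2 ⟨hmem _ (Finset.mem_filter.1 hσ).1, glue_mem_cyl _ _ _⟩
  · intro σ hσ
    exact Finset.mem_filter.2 ⟨hmem _ (Finset.mem_filter.1 hσ).1, glue_mem_cyl _ _ _⟩
  · intro σ hσ
    rw [glue_glue, glue_eq_self (Finset.mem_filter.1 hσ).2]
  · intro σ hσ
    rw [glue_glue, glue_eq_self (Finset.mem_filter.1 hσ).2]
  · intro σ _
    rfl

/-- The local energy difference equals the one in `V`, so the integrand trades the Boltzmann weight
of `η` for that of `η'`. -/
theorem integral_exp_quenched {Λ V : Finset (Site d)} (hΛ : Λ ⊆ V) (σbar : Config d Bool)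
    {η η' : Config d H₀} (hη : ∀ x ∉ Λ, η' x = η x) :
    ∫ σ, Real.exp (-(energy β h Λ σ η' - energy β h Λ σ η))
      ∂(quenched β h σbar V η : Measure (Config d Bool)) =
      partition β h V σbar η' / partition β h V σbar η := by
  rw [integral_quenched]
  congr 1
  refine Finset.sum_congr rfl fun σ _ => ?_
  rw [← energy_sub_energy β h hΛ (fun _ _ => rfl) hη, ← Real.exp_add]
  congr 1; ring

/-- After multiplication by the partition function of `η`, both sides are one sum of weights at
`η'`, indexed by the configuration before or after `Λ` is overwritten. -/
theorem integral_quenched_detailed_balance {Λ V : Finset (Site d)} (hΛ : Λ ⊆ V)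
    (σbar : Config d Bool) {η η' : Config d H₀} (hη : ∀ x ∉ Λ, η' x = η x) (τ τ' : Λ → Bool)
    (f : Config d Bool → ℝ) :
    partition β h V σbar η' / partition β h V σbar η *
      ∫ σ, (cyl Λ τ').indicator (fun σ => f (glue Λ τ σ)) σ
        ∂(quenched β h σbar V η' : Measure (Config d Bool)) =
      ∫ σ, (cyl Λ τ).indicator (fun σ =>
        Real.exp (-(energy β h Λ (glue Λ τ' σ) η' - energy β h Λ σ η)) * f σ) σ
        ∂(quenched β h σbar V η : Measure (Config d Bool)) := by
  rw [integral_quenched, integral_quenched, div_mul_div_comm,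
    mul_comm (partition β h V σbar η) (partition β h V σbar η'),
    mul_div_mul_left _ _ (partition_pos β h _ _ _).ne']
  congr 1
  have h1 : ∀ σ, Real.exp (-energy β h V σ η') *
      (cyl Λ τ').indicator (fun σ => f (glue Λ τ σ)) σ =
      (cyl Λ τ').indicator (fun σ => (fun σ =>
        Real.exp (-energy β h V (glue Λ τ' σ) η') * f σ) (glue Λ τ σ)) σ := by
    intro σ
    by_cases hσ : σ ∈ cyl Λ τ'
    · rw [Set.indicator_of_mem hσ, Set.indicator_of_mem hσ]
      simp only [glue_glue]
      rw [glue_eq_self hσ]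
    · rw [Set.indicator_of_notMem hσ, Set.indicator_of_notMem hσ, mul_zero]
  rw [Finset.sum_congr rfl fun σ _ => h1 σ, sum_cyl_glue hΛ σbar τ τ' fun σ =>
    Real.exp (-energy β h V (glue Λ τ' σ) η') * f σ]
  refine Finset.sum_congr rfl fun σ _ => ?_
  by_cases hσ : σ ∈ cyl Λ τ
  · rw [Set.indicator_of_mem hσ, Set.indicator_of_mem hσ, ← mul_assoc, ← Real.exp_add,
      ← energy_sub_energy β h hΛ (fun x hx => glue_of_notMem _ _ hx) hη]
    congr 2; ring
  · rw [Set.indicator_of_notMem hσ, Set.indicator_of_notMem hσ, mul_zero]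

theorem continuous_exp_energy_sub (Λ : Finset (Site d)) (η η' : Config d H₀) :
    Continuous fun σ : Config d Bool =>
      Real.exp (-(energy β h Λ σ η' - energy β h Λ σ η)) :=
  Real.continuous_exp.comp
    ((continuous_energy β h Λ η').sub (continuous_energy β h Λ η)).neg

/-- The ratio on the left does not involve `Λ` and telescopes in the fields; both facts are
inherited by `Qfun`. -/
theorem tendsto_partition_div (hβ : 0 ≤ β) (s : Bool) (Λ : Finset (Site d)) {η η' : Config d H₀}
    (hη : ∀ x ∉ Λ, η' x = η x) :
    Tendsto (fun V : Finset (Site d) =>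
      partition β h V (fun _ => s) η' / partition β h V (fun _ => s) η) atTop
      (𝓝 (Qfun β h s Λ η' η)) := by
  refine (tendsto_integral_state β h hβ s η
    (continuous_exp_energy_sub β h Λ η η')).congr' ?_
  filter_upwards [eventually_ge_atTop Λ] with V hV
  exact integral_exp_quenched β h hV _ hη

theorem Qfun_eq_of_subset (hβ : 0 ≤ β) (s : Bool) {Λ V : Finset (Site d)} (hΛ : Λ ⊆ V)
    {η η' : Config d H₀} (hη : ∀ x ∉ Λ, η' x = η x) :
    Qfun β h s V η' η = Qfun β h s Λ η' η :=
  tendsto_nhds_unique (tendsto_partition_div β h hβ s V fun x hx => hη x fun h' => hx (hΛ h'))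
    (tendsto_partition_div β h hβ s Λ hη)

theorem Qfun_mul_Qfun (hβ : 0 ≤ β) (s : Bool) (Λ : Finset (Site d)) {η₁ η₂ η₃ : Config d H₀}
    (h12 : ∀ x ∉ Λ, η₁ x = η₂ x) (h23 : ∀ x ∉ Λ, η₂ x = η₃ x) :
    Qfun β h s Λ η₁ η₂ * Qfun β h s Λ η₂ η₃ = Qfun β h s Λ η₁ η₃ := by
  refine tendsto_nhds_unique ((tendsto_partition_div β h hβ s Λ h12).mul
    (tendsto_partition_div β h hβ s Λ h23))
    ((tendsto_partition_div β h hβ s Λ fun x hx => (h12 x hx).trans (h23 x hx)).congr fun V => ?_)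
  rw [div_mul_div_cancel₀ (partition_pos β h _ _ _).ne']

theorem integrable_of_continuous (μ : Measure (Config d Bool)) [IsFiniteMeasure μ]
    {f : Config d Bool → ℝ} (hf : Continuous f) : Integrable f μ :=
  (BoundedContinuousFunction.mkOfCompact ⟨f, hf⟩).integrable μ

theorem exists_Qfun_bounds (s : Bool) (Λ : Finset (Site d)) :
    ∃ C : ℝ, ∀ η η' : Config d H₀,
      Real.exp (-C) ≤ Qfun β h s Λ η' η ∧ Qfun β h s Λ η' η ≤ Real.exp C := by
  obtain ⟨C, hC⟩ := exists_abs_energy_le (H₀ := H₀) β h Λ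
  refine ⟨2 * C, fun η η' => ?_⟩
  have hint := integrable_of_continuous (state β h s η : Measure (Config d Bool))
    (continuous_exp_energy_sub β h Λ η η')
  have hbd : ∀ σ, |energy β h Λ σ η' - energy β h Λ σ η| ≤ 2 * C := fun σ =>
    (abs_sub _ _).trans (by linarith [hC σ η, hC σ η'])
  constructor
  · calc Real.exp (-(2 * C)) = ∫ _, Real.exp (-(2 * C))
          ∂(state β h s η : Measure (Config d Bool)) := by simp
      _ ≤ _ := integral_mono (integrable_const _) hint fun σ =>
          Real.exp_le_exp.2 (neg_le_neg (abs_le.1 (hbd σ)).2)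
  · calc Qfun β h s Λ η' η ≤ ∫ _, Real.exp (2 * C)
          ∂(state β h s η : Measure (Config d Bool)) :=
          integral_mono hint (integrable_const _) fun σ =>
            Real.exp_le_exp.2 (by linarith [(abs_le.1 (hbd σ)).1])
      _ = _ := by simp

theorem Qfun_pos (s : Bool) (Λ : Finset (Site d)) (η η' : Config d H₀) :
    0 < Qfun β h s Λ η' η := by
  obtain ⟨C, hC⟩ := exists_Qfun_bounds (H₀ := H₀) β h s Λ
  exact (Real.exp_pos _).trans_le (hC η η').1

theorem Qfun_self (s : Bool) (Λ : Finset (Site d)) (η : Config d H₀) :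
    Qfun β h s Λ η η = 1 := by
  simp [Qfun]

/-- Cylinders are clopen, so every integrand is continuous and the finite-volume identity survives
the weak limit. -/
theorem integral_state_detailed_balance (hβ : 0 ≤ β) (s : Bool) (Λ : Finset (Site d))
    {η η' : Config d H₀} (hη : ∀ x ∉ Λ, η' x = η x) (τ τ' : Λ → Bool)
    {f : Config d Bool → ℝ} (hf : Continuous f) :
    Qfun β h s Λ η' η * ∫ σ, (cyl Λ τ').indicator (fun σ => f (glue Λ τ σ)) σ
        ∂(state β h s η' : Measure (Config d Bool)) =
      ∫ σ, (cyl Λ τ).indicator (fun σ =>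
        Real.exp (-(energy β h Λ (glue Λ τ' σ) η' - energy β h Λ σ η)) * f σ) σ
        ∂(state β h s η : Measure (Config d Bool)) := by
  have hcl : ∀ (τ : Λ → Bool) {g : Config d Bool → ℝ}, Continuous g →
      Continuous ((cyl Λ τ).indicator g) := fun τ g hg => hg.indicator fun a ha => by
    rw [(isClopen_cylinder Λ τ).frontier_eq] at ha; exact ha.elim
  have h1 := (tendsto_partition_div β h hβ s Λ hη).mul
    (tendsto_integral_state β h hβ s η' (hcl τ' (hf.comp (continuous_glue Λ τ))))
  have h2 := tendsto_integral_state β h hβ s η (hcl τ (g := fun σ =>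
    Real.exp (-(energy β h Λ (glue Λ τ' σ) η' - energy β h Λ σ η)) * f σ)
    ((Real.continuous_exp.comp (((continuous_energy β h Λ η').comp (continuous_glue Λ τ')).sub
      (continuous_energy β h Λ η)).neg).mul hf))
  refine tendsto_nhds_unique h1 (h2.congr' ?_)
  filter_upwards [eventually_ge_atTop Λ] with V hV
  exact (integral_quenched_detailed_balance β h hV _ hη τ τ' f).symm

/-- The continuous version says that two finite measures have the same integrals of bounded
continuous functions; they coincide, which gives all measurable `F`. -/
theorem lintegral_state_detailed_balance (hβ : 0 ≤ β) (s : Bool) (Λ : Finset (Site d))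
    {η η' : Config d H₀} (hη : ∀ x ∉ Λ, η' x = η x) (τ τ' : Λ → Bool)
    {F : Config d Bool → ℝ≥0∞} (hF : Measurable F) :
    ENNReal.ofReal (Qfun β h s Λ η' η) *
        ∫⁻ σ, (cyl Λ τ').indicator (fun σ => F (glue Λ τ σ)) σ
          ∂(state β h s η' : Measure (Config d Bool)) =
      ∫⁻ σ, (cyl Λ τ).indicator (fun σ =>
        ENNReal.ofReal (Real.exp (-(energy β h Λ (glue Λ τ' σ) η' - energy β h Λ σ η))) * F σ) σ
        ∂(state β h s η : Measure (Config d Bool)) := by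
  have hcont : Continuous fun σ : Config d Bool =>
      Real.exp (-(energy β h Λ (glue Λ τ' σ) η' - energy β h Λ σ η)) :=
    Real.continuous_exp.comp (((continuous_energy β h Λ η').comp (continuous_glue Λ τ')).sub
      (continuous_energy β h Λ η)).neg
  have hm1 := measurableSet_cylinder Λ τ
  have hm2 := measurableSet_cylinder Λ τ'
  have hmeas : ENNReal.ofReal (Qfun β h s Λ η' η) •
      (((state β h s η' : Measure (Config d Bool)).restrict (cyl Λ τ')).map (glue Λ τ)) =
      ((state β h s η : Measure (Config d Bool)).restrict (cyl Λ τ)).withDensity fun σ =>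
        ENNReal.ofReal (Real.exp (-(energy β h Λ (glue Λ τ' σ) η' - energy β h Λ σ η))) := by
    have : IsFiniteMeasure (ENNReal.ofReal (Qfun β h s Λ η' η) •
      (((state β h s η' : Measure (Config d Bool)).restrict (cyl Λ τ')).map (glue Λ τ))) :=
      Measure.smul_finite _ ENNReal.ofReal_ne_top
    have := isFiniteMeasure_withDensity_ofReal (integrable_of_continuous
      ((state β h s η : Measure (Config d Bool)).restrict (cyl Λ τ)) hcont).2
    refine ext_of_forall_integral_eq_of_IsFiniteMeasure fun f => ?_
    rw [integral_smul_measure, integral_map (measurable_glue Λ τ).aemeasurable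
      f.continuous.aestronglyMeasurable, ENNReal.toReal_ofReal (Qfun_pos β h s Λ η η').le,
      integral_withDensity_eq_integral_toReal_smul hcont.measurable.ennreal_ofReal
        (Eventually.of_forall fun _ => ENNReal.ofReal_lt_top),
      ← integral_indicator hm1, ← integral_indicator hm2, smul_eq_mul,
      integral_state_detailed_balance β h hβ s Λ hη τ τ' f.continuous]
    simp only [ENNReal.toReal_ofReal (Real.exp_pos _).le, smul_eq_mul]
  have := congrArg (fun ν : Measure (Config d Bool) => ∫⁻ σ, F σ ∂ν) hmeas
  rwa [lintegral_smul_measure, lintegral_map hF (measurable_glue Λ τ),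
    lintegral_withDensity_eq_lintegral_mul _ hcont.measurable.ennreal_ofReal hF,
    ← lintegral_indicator hm1, ← lintegral_indicator hm2] at this

theorem lintegral_indicator_cyl {E : Type} [MeasurableSpace E] [MeasurableSingletonClass E]
    (μ : Measure (Config d E)) (Λ : Finset (Site d)) (ζ : Λ → E) :
    ∫⁻ ω, (cyl Λ ζ).indicator (fun _ => 1) ω ∂μ = μ (cyl Λ ζ) :=
  lintegral_indicator_one (measurableSet_cylinder Λ ζ)

/-- The quenched states charge every cylinder. -/
theorem state_cyl_pos (hβ : 0 ≤ β) (s : Bool) (η : Config d H₀) (Λ : Finset (Site d))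
    (τ : Λ → Bool) : 0 < (state β h s η : Measure (Config d Bool)) (cyl Λ τ) := by
  rw [pos_iff_ne_zero]
  intro h0
  -- Detailed balance at equal fields moves a null cylinder over `Λ` to every other one, but
  -- finitely many of them cover the space.
  have hall : ∀ τ' : Λ → Bool, (state β h s η : Measure (Config d Bool)) (cyl Λ τ') = 0 := by
    intro τ'
    have hdb := lintegral_state_detailed_balance β h hβ s Λ (η := η) (η' := η)
      (fun _ _ => rfl) τ τ' (F := fun _ => 1) measurable_const
    rw [Qfun_self, ENNReal.ofReal_one, one_mul, lintegral_indicator_cyl,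
      lintegral_indicator (measurableSet_cylinder Λ τ), Measure.restrict_eq_zero.2 h0,
      lintegral_zero_measure] at hdb
    exact hdb
  have huniv : (Set.univ : Set (Config d Bool)) = ⋃ τ' : Λ → Bool, cyl Λ τ' := by
    ext σ
    simp only [Set.mem_univ, Set.mem_iUnion, true_iff]
    exact ⟨_, mem_cyl_restrict Λ σ⟩
  have : (state β h s η : Measure (Config d Bool)) Set.univ = 0 := by
    rw [huniv, measure_iUnion_null_iff]
    exact hall
  simp at this

end DetailedBalance

/-! ### Measurability and covariance of the quenched states -/

section Measurability

variable {d : ℕ} {H₀ : Finset ℝ} (β h : ℝ)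

theorem tendsto_cube (d : ℕ) : Tendsto (cube d) atTop atTop := by
  refine tendsto_atTop_finset_of_monotone (fun m n hmn x hx => ?_) fun x => ?_
  · simp only [cube, Fintype.mem_piFinset, Finset.mem_Icc] at hx ⊢
    exact fun i => ⟨by have := (hx i).1; omega, by have := (hx i).2; omega⟩
  · refine ⟨∑ i, (x i).natAbs, ?_⟩
    simp only [cube, Fintype.mem_piFinset, Finset.mem_Icc]
    intro i
    have : (x i).natAbs ≤ ∑ i, (x i).natAbs :=
      Finset.single_le_sum (f := fun i => (x i).natAbs) (fun _ _ => Nat.zero_le _)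
        (Finset.mem_univ i)
    omega

/-- Along the cubes the expectation is a pointwise limit of a sequence of finite sums, each
measurable in the parameter. -/
theorem measurable_integral_state (hβ : 0 ≤ β) (s : Bool) {α : Type*} [MeasurableSpace α]
    {f : α → Config d Bool → ℝ} {g : α → Config d H₀} (hf : ∀ a, Continuous (f a))
    (hf' : ∀ σ, Measurable fun a => f a σ) (hg : Measurable g) :
    Measurable fun a => ∫ σ, f a σ ∂(state β h s (g a) : Measure (Config d Bool)) := by
  refine measurable_of_tendsto_metrizable (f := fun n a => ∫ σ, f a σ
    ∂(quenched β h (fun _ => s) (cube d n) (g a) : Measure (Config d Bool))) (fun n => ?_)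
    (tendsto_pi_nhds.2 fun a =>
      (tendsto_integral_state β h hβ s (g a) (hf a)).comp (tendsto_cube d))
  simp only [integral_quenched, partition]
  have he : ∀ σ : Config d Bool, Measurable fun a => Real.exp (-energy β h (cube d n) σ (g a)) :=
    fun σ => Real.measurable_exp.comp (measurable_energy β h _ measurable_const hg).neg
  exact (Finset.measurable_sum _ fun σ _ => (he σ).mul (hf' σ)).div
    (Finset.measurable_sum _ fun σ _ => he σ)

theorem measurable_Qfun (hβ : 0 ≤ β) (s : Bool) (Λ : Finset (Site d)) {α : Type*}
    [MeasurableSpace α] {g g' : α → Config d H₀} (hg : Measurable g) (hg' : Measurable g') :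
    Measurable fun a => Qfun β h s Λ (g' a) (g a) :=
  measurable_integral_state β h hβ s
    (f := fun a σ => Real.exp (-(energy β h Λ σ (g' a) - energy β h Λ σ (g a))))
    (fun _ => continuous_exp_energy_sub β h Λ _ _)
    (fun _ => Real.measurable_exp.comp ((measurable_energy β h _ measurable_const hg').sub
      (measurable_energy β h _ measurable_const hg)).neg) hg

theorem measurable_state (hβ : 0 ≤ β) (s : Bool) :
    Measurable fun η : Config d H₀ => (state β h s η : Measure (Config d Bool)) := by
  refine Measurable.measure_of_isPiSystem_of_isProbabilityMeasure (generateFrom_allEq s)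
    (isPiSystem_allEq s) ?_
  rintro _ ⟨A, rfl⟩
  have h1 := measurable_integral_state β h hβ s (f := fun (_ : Config d H₀) => allEqInd A s)
    (fun _ => continuous_allEqInd A s) (fun _ => measurable_const) measurable_id
  simp only [integral_allEqInd] at h1
  convert h1.ennreal_ofReal using 2 with η
  exact (ofReal_measureReal (measure_ne_top _ _)).symm

/-- The quenched states, as a kernel. -/
noncomputable def stateKernel (hβ : 0 ≤ β) (s : Bool) :
    Kernel (Config d H₀) (Config d Bool) where
  toFun η := (state β h s η : Measure (Config d Bool))
  measurable' := measurable_state β h hβ s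

instance (hβ : 0 ≤ β) (s : Bool) : IsMarkovKernel (stateKernel (d := d) (H₀ := H₀) β h hβ s) :=
  ⟨fun η => inferInstanceAs (IsProbabilityMeasure (state β h s η : Measure (Config d Bool)))⟩

theorem sum_confs_image_add {E : Type} [Fintype E] {M : Type*} [AddCommMonoid M]
    (V : Finset (Site d)) (x : Site d) (ω : Config d E) (f : Config d E → M) :
    ∑ ξ ∈ confs (V.image (fun y => y + x)) ω, f (shift x ξ) =
      ∑ ξ ∈ confs V (shift x ω), f ξ := by
  refine Finset.sum_bij' (fun ξ _ => shift x ξ) (fun ξ _ => shift (-x) ξ) ?_ ?_ ?_ ?_ ?_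
  · intro ξ hξ
    refine mem_confs.2 fun y hy => mem_confs.1 hξ (x + y) fun hxy => hy ?_
    obtain ⟨z, hz, hzy⟩ := Finset.mem_image.1 hxy
    rw [add_comm x y] at hzy
    exact add_right_cancel hzy ▸ hz
  · intro ξ hξ
    refine mem_confs.2 fun y hy => ?_
    have := mem_confs.1 hξ (-x + y) fun hxy => hy (Finset.mem_image.2 ⟨_, hxy, by abel⟩)
    simpa [shift] using this
  · intro ξ _; exact shift_neg_shift x ξ
  · intro ξ _; exact shift_shift_neg x ξ
  · intro ξ _; rfl

theorem integral_quenched_shift (s : Bool) (V : Finset (Site d)) (x : Site d)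
    (η : Config d H₀) (f : Config d Bool → ℝ) :
    ∫ σ, f (shift x σ)
        ∂(quenched β h (fun _ => s) (V.image (fun y => y + x)) η : Measure (Config d Bool)) =
      ∫ σ, f σ ∂(quenched β h (fun _ => s) V (shift x η) : Measure (Config d Bool)) := by
  rw [integral_quenched, integral_quenched, partition, partition]
  simp only [energy_image_add]
  rw [sum_confs_image_add V x (fun _ => s) fun σ => Real.exp (-energy β h V σ (shift x η)) * f σ,
    sum_confs_image_add V x (fun _ => s) fun σ => Real.exp (-energy β h V σ (shift x η))]
  rfl

theorem tendsto_image_add (x : Site d) :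
    Tendsto (fun V : Finset (Site d) => V.image (fun y => y + x)) atTop atTop := by
  refine tendsto_atTop_finset_of_monotone (fun V W hVW => Finset.image_subset_image hVW)
    fun y => ⟨{y - x}, by simp⟩

/-- The constant boundary condition is shift invariant, and translated volumes still exhaust the
lattice. -/
theorem state_shift (hβ : 0 ≤ β) (s : Bool) (x : Site d) (η : Config d H₀) :
    (state β h s (shift x η) : Measure (Config d Bool)) =
      (state β h s η : Measure (Config d Bool)).map (shift x) := by
  have : IsFiniteMeasure ((state β h s η : Measure (Config d Bool)).map (shift x)) :=
    inferInstance
  refine ext_of_forall_integral_eq_of_IsFiniteMeasure fun f => ?_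
  rw [integral_map (measurable_shift x).aemeasurable f.continuous.aestronglyMeasurable]
  refine tendsto_nhds_unique (tendsto_integral_state β h hβ s (shift x η) f.continuous) ?_
  refine ((tendsto_integral_state β h hβ s η (f.continuous.comp (continuous_shift x))).comp
    (tendsto_image_add x)).congr fun V => ?_
  exact integral_quenched_shift β h s V x η f

theorem Qfun_image_add (hβ : 0 ≤ β) (s : Bool) (Λ : Finset (Site d)) (x : Site d)
    (η η' : Config d H₀) :
    Qfun β h s (Λ.image (fun y => y + x)) η' η = Qfun β h s Λ (shift x η') (shift x η) := by
  rw [Qfun, Qfun, state_shift β h hβ, integral_map (measurable_shift x).aemeasurable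
    (continuous_exp_energy_sub β h Λ _ _).aestronglyMeasurable]
  simp only [energy_image_add]

end Measurability

end RandomField

namespace RandomField

/-! ### Specifications given by weights -/

section GibbsKernel

variable {d : ℕ} {E : Type} [Fintype E]

theorem indicator_one_congr {α : Type*} {A B : Set α} {a b : α} (hab : a ∈ A ↔ b ∈ B) :
    A.indicator (1 : α → ℝ≥0∞) a = B.indicator 1 b := by
  by_cases ha : a ∈ A
  · rw [Set.indicator_of_mem ha, Set.indicator_of_mem (hab.1 ha), Pi.one_apply, Pi.one_apply]
  · rw [Set.indicator_of_notMem ha, Set.indicator_of_notMem fun hb => ha (hab.2 hb)]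

/-- The family of kernels `γ_Λ(ξ | ω) = W_Λ(ξ) / ∑ W_Λ(ξ')` with weights `W`, where the sum is over
the configurations that agree with `ω` off `Λ`. -/
noncomputable def gibbsKernel [MeasurableSpace E] (W : Finset (Site d) → Config d E → ℝ) : KernelFamily d E :=
  fun Λ ω => ∑ ξ ∈ confs Λ ω,
    ENNReal.ofReal (W Λ ξ / ∑ ξ' ∈ confs Λ ω, W Λ ξ') • Measure.dirac ξ

/-- The weights in different volumes are compatible. -/
def IsCompatible (W : Finset (Site d) → Config d E → ℝ) : Prop :=
  ∀ Λ V : Finset (Site d), Λ ⊆ V → ∀ ξ ξ' : Config d E, (∀ x ∉ Λ, ξ x = ξ' x) →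
    W Λ ξ * W V ξ' = W V ξ * W Λ ξ'

theorem confs_eq_of_mem {Λ : Finset (Site d)} {ω ω' : Config d E} (hω : ∀ x ∉ Λ, ω x = ω' x) :
    confs Λ ω = confs Λ ω' := by
  ext ξ
  simp only [mem_confs]
  exact ⟨fun h x hx => (h x hx).trans (hω x hx), fun h x hx => (h x hx).trans (hω x hx).symm⟩

theorem self_mem_confs (Λ : Finset (Site d)) (ω : Config d E) : ω ∈ confs Λ ω :=
  mem_confs.2 fun _ _ => rfl

variable {W : Finset (Site d) → Config d E → ℝ}

theorem sum_confs_pos (hW : ∀ Λ ξ, 0 < W Λ ξ) (Λ : Finset (Site d)) (ω : Config d E) :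
    0 < ∑ ξ ∈ confs Λ ω, W Λ ξ :=
  Finset.sum_pos (fun _ _ => hW _ _) ⟨ω, self_mem_confs Λ ω⟩

theorem sum_gibbs_weights (hW : ∀ Λ ξ, 0 < W Λ ξ) (Λ : Finset (Site d)) (ω : Config d E) :
    ∑ ξ ∈ confs Λ ω, ENNReal.ofReal (W Λ ξ / ∑ ξ' ∈ confs Λ ω, W Λ ξ') = 1 := by
  rw [← ENNReal.ofReal_sum_of_nonneg
    fun ξ _ => div_nonneg (hW _ _).le (sum_confs_pos hW Λ ω).le, ← Finset.sum_div,
    div_self (sum_confs_pos hW Λ ω).ne', ENNReal.ofReal_one]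

/-- Swapping the old and the new configuration in a single resampling step. -/
theorem sum_confs_sum_confs_comm {M : Type*} [AddCommMonoid M] {Λ V : Finset (Site d)}
    (hΛ : Λ ⊆ V) (ω : Config d E) (F : Config d E → Config d E → M) :
    ∑ ξ ∈ confs V ω, ∑ ξ' ∈ confs Λ ξ, F ξ ξ' = ∑ ξ ∈ confs V ω, ∑ ξ' ∈ confs Λ ξ, F ξ' ξ := by
  refine Finset.sum_comm' fun ξ ξ' => ?_
  simp only [mem_confs]
  constructor
  · rintro ⟨h1, h2⟩
    exact ⟨fun x hx => (h2 x hx).symm,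
      fun x hx => (h2 x fun h' => hx (hΛ h')).trans (h1 x hx)⟩
  · rintro ⟨h1, h2⟩
    exact ⟨fun x hx => (h1 x fun h' => hx (hΛ h')).trans (h2 x hx),
      fun x hx => (h1 x hx).symm⟩

variable [MeasurableSpace E]

theorem gibbsKernel_apply (Λ : Finset (Site d)) (ω : Config d E) {A : Set (Config d E)}
    (hA : MeasurableSet A) :
    gibbsKernel W Λ ω A = ∑ ξ ∈ confs Λ ω,
      ENNReal.ofReal (W Λ ξ / ∑ ξ' ∈ confs Λ ω, W Λ ξ') * A.indicator 1 ξ := by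
  simp only [gibbsKernel, Measure.coe_finsetSum, Finset.sum_apply, Measure.smul_apply,
    smul_eq_mul, Measure.dirac_apply' _ hA]

theorem lintegral_gibbsKernel (Λ : Finset (Site d)) (ω : Config d E) {f : Config d E → ℝ≥0∞}
    (hf : Measurable f) :
    ∫⁻ ξ, f ξ ∂(gibbsKernel W Λ ω) = ∑ ξ ∈ confs Λ ω,
      ENNReal.ofReal (W Λ ξ / ∑ ξ' ∈ confs Λ ω, W Λ ξ') * f ξ := by
  simp only [gibbsKernel, lintegral_finsetSum_measure, lintegral_smul_measure,
    lintegral_dirac' _ hf, smul_eq_mul]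

theorem gibbsKernel_congr {Λ : Finset (Site d)} {ω ω' : Config d E}
    (hω : ∀ x ∉ Λ, ω x = ω' x) : gibbsKernel W Λ ω = gibbsKernel W Λ ω' := by
  rw [gibbsKernel, gibbsKernel, confs_eq_of_mem hω]

theorem measurable_gibbsKernel_apply (hm : ∀ Λ, Measurable (W Λ)) (Λ : Finset (Site d))
    {A : Set (Config d E)} (hA : MeasurableSet A) : Measurable fun ω => gibbsKernel W Λ ω A := by
  simp only [gibbsKernel_apply Λ _ hA, sum_confs]
  refine Finset.measurable_sum _ fun ζ _ => Measurable.mul ?_ ?_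
  · exact (((hm Λ).comp (measurable_glue Λ ζ)).div
      (Finset.measurable_sum _ fun ζ' _ => (hm Λ).comp (measurable_glue Λ ζ'))).ennreal_ofReal
  · exact (measurable_one.indicator hA).comp (measurable_glue Λ ζ)

/-- Consistency is reversibility: with old and new configuration exchanged, the inner sum is the
total mass of a probability kernel. -/
theorem isSpecification_gibbsKernel [Nonempty E] (hW : ∀ Λ ξ, 0 < W Λ ξ)
    (hm : ∀ Λ, Measurable (W Λ)) (hc : IsCompatible W) : IsSpecification (gibbsKernel W) where
  isProb Λ ω := ⟨by
    rw [gibbsKernel_apply Λ ω MeasurableSet.univ]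
    simp only [Set.indicator_univ, Pi.one_apply, mul_one]
    exact sum_gibbs_weights hW Λ ω⟩
  measurable Λ A hA := by
    obtain ⟨e⟩ := ‹Nonempty E›
    refine measurable_sigmaAlg_compl Λ (fun _ => e) (measurable_gibbsKernel_apply hm Λ hA)
      fun ω => ?_
    rw [gibbsKernel_congr fun x hx => glue_of_notMem _ _ hx]
  proper Λ B hB ω := by
    rw [gibbsKernel_apply Λ ω (cylinderEvents_le_pi _ hB)]
    have : ∀ ξ ∈ confs Λ ω, B.indicator (1 : Config d E → ℝ≥0∞) ξ = B.indicator 1 ω := by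
      intro ξ hξ
      exact indicator_one_congr (mem_iff_of_measurableSet_sigmaAlg hB fun x hx =>
        mem_confs.1 hξ x (by simpa using hx))
    rw [Finset.sum_congr rfl fun ξ hξ => by rw [this ξ hξ], ← Finset.sum_mul,
      sum_gibbs_weights hW, one_mul]
  consistent Λ V hΛ A hA ω := by
    rw [lintegral_gibbsKernel V ω (measurable_gibbsKernel_apply hm Λ hA),
      gibbsKernel_apply V ω hA]
    simp only [gibbsKernel_apply Λ _ hA, Finset.mul_sum]
    rw [sum_confs_sum_confs_comm hΛ ω fun ξ ξ' =>
      ENNReal.ofReal (W V ξ / ∑ ξ'' ∈ confs V ω, W V ξ'') *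
        (ENNReal.ofReal (W Λ ξ' / ∑ ξ'' ∈ confs Λ ξ, W Λ ξ'') * A.indicator 1 ξ')]
    refine Finset.sum_congr rfl fun ξ _ => ?_
    -- Compatibility is detailed balance between `ξ` and `ξ'`. The normalization in `Λ` is common to
    -- both, as they agree off `Λ`.
    have hterm : ∀ ξ' ∈ confs Λ ξ, ENNReal.ofReal (W V ξ' / ∑ ξ'' ∈ confs V ω, W V ξ'') *
        (ENNReal.ofReal (W Λ ξ / ∑ ξ'' ∈ confs Λ ξ', W Λ ξ'') * A.indicator 1 ξ) =
        ENNReal.ofReal (W V ξ / ∑ ξ'' ∈ confs V ω, W V ξ'') *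
        (ENNReal.ofReal (W Λ ξ' / ∑ ξ'' ∈ confs Λ ξ, W Λ ξ'') * A.indicator 1 ξ) := by
      intro ξ' hξ'
      rw [confs_eq_of_mem (mem_confs.1 hξ'), ← mul_assoc, ← mul_assoc,
        ← ENNReal.ofReal_mul (div_nonneg (hW _ _).le (sum_confs_pos hW V ω).le),
        ← ENNReal.ofReal_mul (div_nonneg (hW _ _).le (sum_confs_pos hW V ω).le),
        div_mul_div_comm, div_mul_div_comm, mul_comm (W V ξ'),
        hc Λ V hΛ ξ ξ' fun x hx => (mem_confs.1 hξ' x hx).symm]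
    rw [Finset.sum_congr rfl hterm, ← Finset.mul_sum, ← Finset.sum_mul, sum_gibbs_weights hW,
      one_mul]

theorem gibbsKernel_real_cyl [MeasurableSingletonClass E] (hW : ∀ Λ ξ, 0 < W Λ ξ)
    (Λ : Finset (Site d)) (ω : Config d E) (ζ : Λ → E) :
    (gibbsKernel W Λ ω).real (cyl Λ ζ) = W Λ (glue Λ ζ ω) / ∑ ξ ∈ confs Λ ω, W Λ ξ := by
  rw [measureReal_def, gibbsKernel_apply Λ ω (measurableSet_cylinder Λ ζ),
    Finset.sum_eq_single (glue Λ ζ ω)]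
  · rw [Set.indicator_of_mem (glue_mem_cyl Λ ζ ω), Pi.one_apply, mul_one,
      ENNReal.toReal_ofReal (div_nonneg (hW _ _).le (sum_confs_pos hW Λ ω).le)]
  · intro ξ hξ hne
    rw [Set.indicator_of_notMem, mul_zero]
    intro hmem
    exact hne (by rw [← glue_congr ζ (mem_confs.1 hξ), glue_eq_self hmem])
  · intro hn
    exact (hn (mem_confs.2 fun x hx => glue_of_notMem _ _ hx)).elim

/-- Comparable weights give each configuration at least the share `c = 1 / (M * card)`. The upper
bound `1 - c` holds because a second configuration exists and also takes its share; this needs `Λ`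
nonempty and `E` nontrivial. -/
theorem isNonnull_gibbsKernel [MeasurableSingletonClass E] [Nontrivial E]
    (hW : ∀ Λ ξ, 0 < W Λ ξ)
    (hb : ∀ Λ, ∃ M : ℝ, ∀ ξ ξ' : Config d E, W Λ ξ ≤ M * W Λ ξ') :
    IsNonnull (gibbsKernel W) := by
  intro Λ hΛ
  obtain ⟨M, hM⟩ := hb Λ
  obtain ⟨e, e', hee⟩ := exists_pair_ne E
  have hMpos : 0 < M := by
    have := hM (fun _ => e) (fun _ => e)
    exact pos_of_mul_pos_left ((hW Λ fun _ => e).trans_le this) (hW Λ fun _ => e).le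
  have hN : 0 < (Fintype.card (Λ → E) : ℝ) := Nat.cast_pos.2 Fintype.card_pos
  have hlow : ∀ (ζ : Λ → E) (ω : Config d E), (M * Fintype.card (Λ → E))⁻¹ ≤
      W Λ (glue Λ ζ ω) / ∑ ξ ∈ confs Λ ω, W Λ ξ := by
    intro ζ ω
    rw [le_div_iff₀ (sum_confs_pos hW Λ ω), inv_mul_le_iff₀ (mul_pos hMpos hN), sum_confs]
    calc ∑ ζ' : Λ → E, W Λ (glue Λ ζ' ω) ≤ ∑ _ζ' : Λ → E, M * W Λ (glue Λ ζ ω) :=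
          Finset.sum_le_sum fun _ _ => hM _ _
      _ = _ := by rw [Finset.sum_const, Finset.card_univ, nsmul_eq_mul]; ring
  have hup : ∀ (ζ : Λ → E) (ω : Config d E),
      W Λ (glue Λ ζ ω) / ∑ ξ ∈ confs Λ ω, W Λ ξ ≤ 1 - (M * Fintype.card (Λ → E))⁻¹ := by
    intro ζ ω
    obtain ⟨x, hx⟩ := hΛ
    obtain ⟨ζ', hζ'⟩ : ∃ ζ' : Λ → E, ζ ≠ ζ' := by
      by_cases hζ : ζ ⟨x, hx⟩ = e
      · exact ⟨fun _ => e', fun h' => hee (by rw [← hζ, h'])⟩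
      · exact ⟨fun _ => e, fun h' => hζ (by rw [h'])⟩
    have hpair : W Λ (glue Λ ζ ω) + W Λ (glue Λ ζ' ω) ≤ ∑ ξ ∈ confs Λ ω, W Λ ξ := by
      classical
      rw [sum_confs, ← Finset.sum_pair (f := fun ζ => W Λ (glue Λ ζ ω)) hζ']
      exact Finset.sum_le_sum_of_subset_of_nonneg (Finset.subset_univ _)
        fun _ _ _ => (hW _ _).le
    have h1 := (div_le_one (sum_confs_pos hW Λ ω)).2 hpair
    rw [add_div] at h1
    linarith [hlow ζ' ω]
  have hc : 0 < (M * Fintype.card (Λ → E))⁻¹ := inv_pos.2 (mul_pos hMpos hN)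
  have hle := (hlow (fun _ => e) fun _ => e).trans (hup (fun _ => e) fun _ => e)
  -- The two bounds show only `c ≤ 1 - c`; halving makes the required inequality strict.
  refine ⟨(M * Fintype.card (Λ → E))⁻¹ / 2, 1 - (M * Fintype.card (Λ → E))⁻¹ / 2, by linarith,
    by linarith, by linarith, fun ζ ω => ?_⟩
  rw [gibbsKernel_real_cyl hW]
  exact ⟨by linarith [hlow ζ ω], by linarith [hup ζ ω]⟩

theorem isTranslationInvariant_gibbsKernel
    (hs : ∀ Λ x ω, W (Λ.image fun y => y + x) ω = W Λ (shift x ω)) :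
    IsTranslationInvariant (gibbsKernel W) := by
  intro Λ x A hA ω
  have hinj : Function.Injective (shift x : Config d E → Config d E) :=
    Function.LeftInverse.injective (shift_neg_shift x)
  have himg : shift x '' A = shift (-x) ⁻¹' A :=
    congrFun (Set.image_eq_preimage_of_inverse (shift_neg_shift x) (shift_shift_neg x)) A
  rw [gibbsKernel_apply _ ω hA,
    gibbsKernel_apply Λ _ (by rw [himg]; exact measurable_shift (-x) hA)]
  simp only [hs]
  rw [sum_confs_image_add Λ x ω (W Λ), ← sum_confs_image_add Λ x ω fun ξ =>
    ENNReal.ofReal (W Λ ξ / ∑ ξ' ∈ confs Λ (shift x ω), W Λ ξ') * (shift x '' A).indicator 1 ξ]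
  refine Finset.sum_congr rfl fun ξ _ => ?_
  rw [indicator_one_congr (B := shift x '' A) (b := shift x ξ) hinj.mem_set_image.symm]

end GibbsKernel

/-! ### The specifications of the joint measures -/

section JointSpec

variable {d : ℕ} {H₀ : Finset ℝ} (β h : ℝ) (P₀ : Measure H₀)

theorem fields_glue (Λ : Finset (Site d)) (ζ : Λ → Bool × H₀) (ξ : Config d (Bool × H₀)) :
    fields (glue Λ ζ ξ) = glue Λ (fun x => (ζ x).2) (fields ξ) := glue_comp Prod.snd Λ ζ ξ

theorem spins_glue (Λ : Finset (Site d)) (ζ : Λ → Bool × H₀) (ξ : Config d (Bool × H₀)) :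
    spins (glue Λ ζ ξ) = glue Λ (fun x => (ζ x).1) (spins ξ) := glue_comp Prod.fst Λ ζ ξ

theorem measurable_fields : Measurable (fields : Config d (Bool × H₀) → Config d H₀) :=
  measurable_pi_lambda _ fun x => measurable_snd.comp (measurable_pi_apply x)

theorem measurable_spins : Measurable (spins : Config d (Bool × H₀) → Config d Bool) :=
  measurable_pi_lambda _ fun x => measurable_fst.comp (measurable_pi_apply x)

/-- The weights of the specification `γ^s`, relative to the reference field `a₀`. -/
noncomputable def jointWeight (a₀ : H₀) (s : Bool) (Λ : Finset (Site d))
    (ξ : Config d (Bool × H₀)) : ℝ :=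
  annealedWeight β h P₀ Λ ξ / Qfun β h s Λ (fields ξ) (glue Λ (fun _ => a₀) (fields ξ))

variable {P₀}

theorem annealedWeight_pos (hP : ∀ a, 0 < P₀.real {a}) (Λ : Finset (Site d))
    (ξ : Config d (Bool × H₀)) : 0 < annealedWeight β h P₀ Λ ξ :=
  mul_pos (Real.exp_pos _) (Finset.prod_pos fun _ _ => hP _)

theorem jointWeight_pos (hP : ∀ a, 0 < P₀.real {a}) (a₀ : H₀) (s : Bool) (Λ : Finset (Site d))
    (ξ : Config d (Bool × H₀)) : 0 < jointWeight β h P₀ a₀ s Λ ξ :=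
  div_pos (annealedWeight_pos β h hP Λ ξ) (Qfun_pos β h s Λ _ _)

/-- Comparing the weights of two configurations that agree off `Λ`. -/
theorem jointWeight_eq_of_agree (hβ : 0 ≤ β) (a₀ : H₀) (s : Bool) (Λ : Finset (Site d))
    {ξ ξ' : Config d (Bool × H₀)} (hξ : ∀ x ∉ Λ, ξ' x = ξ x) :
    jointWeight β h P₀ a₀ s Λ ξ' = annealedWeight β h P₀ Λ ξ' /
      (Qfun β h s Λ (fields ξ') (fields ξ) *
        Qfun β h s Λ (fields ξ) (glue Λ (fun _ => a₀) (fields ξ))) := by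
  have hf : ∀ x ∉ Λ, fields ξ' x = fields ξ x := fun x hx => congrArg Prod.snd (hξ x hx)
  rw [jointWeight, glue_congr _ hf, Qfun_mul_Qfun β h hβ s Λ hf
    fun x hx => (glue_of_notMem _ _ hx).symm]

theorem annealedWeight_mul_annealedWeight {Λ V : Finset (Site d)} (hΛ : Λ ⊆ V)
    {ξ ξ' : Config d (Bool × H₀)} (hξ : ∀ x ∉ Λ, ξ x = ξ' x) :
    annealedWeight β h P₀ Λ ξ * annealedWeight β h P₀ V ξ' =
      annealedWeight β h P₀ V ξ * annealedWeight β h P₀ Λ ξ' := by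
  have hE := energy_sub_energy β h hΛ (σ := spins ξ) (σ' := spins ξ') (η := fields ξ)
    (η' := fields ξ') (fun x hx => congrArg Prod.fst (hξ x hx))
    (fun x hx => congrArg Prod.snd (hξ x hx))
  have hprod : ∀ ξ : Config d (Bool × H₀), ∏ x ∈ V, P₀.real {fields ξ x} =
      (∏ x ∈ V \ Λ, P₀.real {fields ξ x}) * ∏ x ∈ Λ, P₀.real {fields ξ x} := fun ξ =>
    (Finset.prod_sdiff hΛ).symm
  have hprod' : ∏ x ∈ V \ Λ, P₀.real {fields ξ x} = ∏ x ∈ V \ Λ, P₀.real {fields ξ' x} :=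
    Finset.prod_congr rfl fun x hx => by
      rw [show fields ξ x = fields ξ' x from
        congrArg Prod.snd (hξ x (Finset.mem_sdiff.1 hx).2)]
  have hexp : Real.exp (-energy β h Λ (spins ξ) (fields ξ)) *
      Real.exp (-energy β h V (spins ξ') (fields ξ')) =
      Real.exp (-energy β h V (spins ξ) (fields ξ)) *
      Real.exp (-energy β h Λ (spins ξ') (fields ξ')) := by
    rw [← Real.exp_add, ← Real.exp_add]
    congr 1; linarith
  simp only [annealedWeight, hprod, hprod']
  linear_combination (∏ x ∈ Λ, P₀.real {fields ξ x}) * (∏ x ∈ Λ, P₀.real {fields ξ' x}) *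
    (∏ x ∈ V \ Λ, P₀.real {fields ξ' x}) * hexp

/-- Annealed weights are compatible. Written relative to `ξ'`, the remaining factor `Qfun` of the
fields of `ξ` is the same in `Λ` and in `V`, since the fields agree off `Λ`. -/
theorem isCompatible_jointWeight (hβ : 0 ≤ β) (a₀ : H₀) (s : Bool) :
    IsCompatible (jointWeight (d := d) β h P₀ a₀ s) := by
  intro Λ V hΛ ξ ξ' hξ
  have hf : ∀ x ∉ Λ, fields ξ x = fields ξ' x := fun x hx => congrArg Prod.snd (hξ x hx)
  rw [jointWeight_eq_of_agree β h hβ a₀ s Λ hξ,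
    jointWeight_eq_of_agree β h hβ a₀ s V fun x hx => hξ x fun h' => hx (hΛ h'),
    Qfun_eq_of_subset β h hβ s hΛ hf, jointWeight, jointWeight, div_mul_div_comm,
    div_mul_div_comm, annealedWeight_mul_annealedWeight β h hΛ hξ]
  congr 1; ring

theorem measurable_jointWeight (hβ : 0 ≤ β) (a₀ : H₀) (s : Bool) (Λ : Finset (Site d)) :
    Measurable (jointWeight β h P₀ a₀ s Λ) := by
  refine Measurable.div (Measurable.mul ?_ ?_) ?_
  · exact Real.measurable_exp.comp (measurable_energy β h Λ measurable_spins measurable_fields).neg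
  · refine Finset.measurable_prod _ fun x _ => ?_
    exact (measurable_of_countable fun a : H₀ => P₀.real {a}).comp
      ((measurable_pi_apply x).comp measurable_fields)
  · exact measurable_Qfun β h hβ s Λ ((measurable_glue Λ _).comp measurable_fields)
      measurable_fields

theorem jointWeight_image_add (hβ : 0 ≤ β) (a₀ : H₀) (s : Bool) (Λ : Finset (Site d))
    (x : Site d) (ξ : Config d (Bool × H₀)) :
    jointWeight β h P₀ a₀ s (Λ.image fun y => y + x) ξ =
      jointWeight β h P₀ a₀ s Λ (shift x ξ) := by
  have hmem : ∀ y, x + y ∈ Λ.image (fun y => y + x) ↔ y ∈ Λ := by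
    intro y
    rw [add_comm, Finset.mem_image]
    exact ⟨fun ⟨z, hz, hzy⟩ => add_right_cancel hzy ▸ hz, fun hy => ⟨y, hy, rfl⟩⟩
  rw [jointWeight, jointWeight, Qfun_image_add β h hβ, annealedWeight, annealedWeight,
    energy_image_add, Finset.prod_image (add_left_injective x).injOn]
  congr 2
  · exact Finset.prod_congr rfl fun y _ => by simp only [fields, shift, add_comm]
  · funext y
    by_cases hy : y ∈ Λ
    · rw [glue_of_mem _ _ hy, shift, glue_of_mem _ _ ((hmem y).2 hy)]
    · rw [glue_of_notMem _ _ hy, shift, glue_of_notMem _ _ fun h' => hy ((hmem y).1 h')]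
      rfl

theorem exists_jointWeight_le [IsProbabilityMeasure P₀] (hP : ∀ a, 0 < P₀.real {a}) (a₀ : H₀)
    (s : Bool) (Λ : Finset (Site d)) :
    ∃ M : ℝ, ∀ ξ ξ' : Config d (Bool × H₀),
      jointWeight β h P₀ a₀ s Λ ξ ≤ M * jointWeight β h P₀ a₀ s Λ ξ' := by
  obtain ⟨C, hC⟩ := exists_abs_energy_le (H₀ := H₀) β h Λ
  obtain ⟨C', hC'⟩ := exists_Qfun_bounds (H₀ := H₀) β h s Λ
  have : Nonempty H₀ := ⟨a₀⟩
  obtain ⟨a, ha⟩ := Finite.exists_min fun a : H₀ => P₀.real {a}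
  have hup : ∀ ξ : Config d (Bool × H₀),
      jointWeight β h P₀ a₀ s Λ ξ ≤ Real.exp C / Real.exp (-C') := by
    intro ξ
    refine div_le_div₀ (Real.exp_pos _).le ?_ (Real.exp_pos _) (hC' _ _).1
    rw [annealedWeight, ← mul_one (Real.exp C)]
    exact mul_le_mul (Real.exp_le_exp.2 (neg_le.1 (abs_le.1 (hC _ _)).1))
      (Finset.prod_le_one (fun _ _ => (hP _).le) fun _ _ => measureReal_le_one)
      (Finset.prod_nonneg fun _ _ => (hP _).le) (Real.exp_pos _).le
  have hlowpos : 0 < Real.exp (-C) * P₀.real {a} ^ Λ.card / Real.exp C' :=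
    div_pos (mul_pos (Real.exp_pos _) (pow_pos (hP a) _)) (Real.exp_pos _)
  have hlow : ∀ ξ : Config d (Bool × H₀),
      Real.exp (-C) * P₀.real {a} ^ Λ.card / Real.exp C' ≤ jointWeight β h P₀ a₀ s Λ ξ := by
    intro ξ
    refine div_le_div₀ (annealedWeight_pos β h hP Λ ξ).le ?_ (Qfun_pos β h s Λ _ _) (hC' _ _).2
    refine mul_le_mul (Real.exp_le_exp.2 (neg_le_neg (abs_le.1 (hC _ _)).2)) ?_
      (pow_pos (hP a) _).le (Real.exp_pos _).le
    rw [← Finset.prod_const]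
    exact Finset.prod_le_prod (fun _ _ => (hP a).le) fun x _ => ha _
  refine ⟨Real.exp C / Real.exp (-C') / (Real.exp (-C) * P₀.real {a} ^ Λ.card / Real.exp C'),
    fun ξ ξ' => ?_⟩
  rw [div_mul_eq_mul_div, le_div_iff₀ hlowpos]
  exact mul_le_mul (hup ξ) (hlow ξ') hlowpos.le
    (div_pos (Real.exp_pos _) (Real.exp_pos _)).le

/-- By the cocycle rule, each `Qfun` in the denominator splits as a quotient of two values at the
reference field. The numerator of this quotient leaves the sum and the denominator completes a
weight; the annealed normalization cancels. -/
theorem jointDensity_eq (hβ : 0 ≤ β) (hP : ∀ a, 0 < P₀.real {a}) (a₀ : H₀) (s : Bool)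
    (Λ : Finset (Site d)) (ζ : Λ → Bool × H₀) (ξ : Config d (Bool × H₀)) :
    jointDensity β h P₀ s Λ ζ ξ = jointWeight β h P₀ a₀ s Λ (glue Λ ζ ξ) /
      ∑ ξ' ∈ confs Λ ξ, jointWeight β h P₀ a₀ s Λ ξ' := by
  have hZ : 0 < ∑ ζ' : Λ → Bool × H₀, annealedWeight β h P₀ Λ (glue Λ ζ' ξ) :=
    Finset.sum_pos (fun _ _ => annealedWeight_pos β h hP _ _) ⟨ζ, Finset.mem_univ _⟩
  set Z := ∑ ζ' : Λ → Bool × H₀, annealedWeight β h P₀ Λ (glue Λ ζ' ξ)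
  set η₀ : Config d H₀ := glue Λ (fun _ => a₀) (fields ξ)
  have hg : ∀ ζ' : Λ → Bool × H₀, ∀ x ∉ Λ, fields (glue Λ ζ' ξ) x = fields ξ x :=
    fun ζ' x hx => congrArg Prod.snd (glue_of_notMem _ _ hx)
  have hη₀ : ∀ x ∉ Λ, η₀ x = fields ξ x := fun x hx => glue_of_notMem _ _ hx
  have hw : ∀ ζ' : Λ → Bool × H₀, jointWeight β h P₀ a₀ s Λ (glue Λ ζ' ξ) =
      annealedWeight β h P₀ Λ (glue Λ ζ' ξ) / Qfun β h s Λ (fields (glue Λ ζ' ξ)) η₀ :=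
    fun ζ' => by rw [jointWeight, glue_congr _ (hg ζ')]
  have hterm : ∀ ζ' : Λ → Bool × H₀, annealed β h P₀ Λ ζ' ξ *
      Qfun β h s Λ (fields (glue Λ ζ ξ)) (fields (glue Λ ζ' ξ)) =
      Qfun β h s Λ (fields (glue Λ ζ ξ)) η₀ / Z *
        jointWeight β h P₀ a₀ s Λ (glue Λ ζ' ξ) := by
    intro ζ'
    have hQ := Qfun_mul_Qfun β h hβ s Λ
      (fun x hx => (hg ζ x hx).trans (hg ζ' x hx).symm)
      (fun x hx => (hg ζ' x hx).trans (hη₀ x hx).symm)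
    rw [hw, ← hQ]
    change annealedWeight β h P₀ Λ (glue Λ ζ' ξ) / Z * _ = _
    have hne := (Qfun_pos β h s Λ η₀ (fields (glue Λ ζ' ξ))).ne'
    have hZ' := hZ.ne'
    field_simp
  rw [jointDensity, Finset.sum_congr rfl fun ζ' _ => hterm ζ', ← Finset.mul_sum, sum_confs,
    hw ζ]
  have hne := (Qfun_pos β h s Λ η₀ (fields (glue Λ ζ ξ))).ne'
  have hZ' := hZ.ne'
  have hS : (∑ ζ' : Λ → Bool × H₀, jointWeight β h P₀ a₀ s Λ (glue Λ ζ' ξ)) ≠ 0 :=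
    (Finset.sum_pos (fun _ _ => jointWeight_pos β h hP a₀ s _ _) ⟨ζ, Finset.mem_univ _⟩).ne'
  change annealedWeight β h P₀ Λ (glue Λ ζ ξ) / Z / _ = _
  field_simp

theorem jointSpec_eq_gibbsKernel (hβ : 0 ≤ β) (hP : ∀ a, 0 < P₀.real {a}) (a₀ : H₀) (s : Bool) :
    jointSpec (d := d) β h P₀ s = gibbsKernel (jointWeight β h P₀ a₀ s) := by
  funext Λ ξ
  rw [jointSpec, gibbsKernel, sum_confs]
  exact Finset.sum_congr rfl fun ζ _ => by rw [jointDensity_eq β h hβ hP a₀]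

/-- Outside spins enter only through the energy of `Λ`, since `Qfun` sees the fields alone. That `A`
is an event in `Λ` keeps its indicator free of them too. -/
theorem hasFiniteSpinRange_jointSpec (hβ : 0 ≤ β) (hP : ∀ a, 0 < P₀.real {a}) (a₀ : H₀)
    (s : Bool) : HasFiniteSpinRange (jointSpec (d := d) β h P₀ s) := by
  intro Λ A hA
  refine ⟨neighborhood Λ, fun ξ ξ' hf hσ => ?_⟩
  have hW : ∀ ζ : Λ → Bool × H₀, jointWeight β h P₀ a₀ s Λ (glue Λ ζ ξ) =
      jointWeight β h P₀ a₀ s Λ (glue Λ ζ ξ') := by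
    intro ζ
    rw [jointWeight, jointWeight, annealedWeight, annealedWeight, fields_glue, fields_glue, hf,
      spins_glue, spins_glue, energy_congr_spins β h (σ' := glue Λ (fun x => (ζ x).1) (spins ξ'))]
    intro x hx
    by_cases hxΛ : x ∈ Λ
    · rw [glue_of_mem _ _ hxΛ, glue_of_mem _ _ hxΛ]
    · rw [glue_of_notMem _ _ hxΛ, glue_of_notMem _ _ hxΛ, hσ x hx]
  have hA' := cylinderEvents_le_pi _ hA
  have hind : ∀ ζ : Λ → Bool × H₀, A.indicator (1 : Config d (Bool × H₀) → ℝ≥0∞) (glue Λ ζ ξ) =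
      A.indicator 1 (glue Λ ζ ξ') := by
    intro ζ
    exact indicator_one_congr (mem_iff_of_measurableSet_sigmaAlg hA fun x hx => by
      rw [glue_of_mem _ _ hx, glue_of_mem _ _ hx])
  rw [jointSpec_eq_gibbsKernel β h hβ hP a₀, gibbsKernel_apply Λ _ hA', gibbsKernel_apply Λ _ hA']
  simp only [sum_confs, hW, hind]

end JointSpec

end RandomField

namespace RandomField

/-! ### The disorder law -/

section Disorder

variable {d : ℕ} {H₀ : Finset ℝ} (P₀ : Measure H₀) [IsProbabilityMeasure P₀]

instance : IsProbabilityMeasure (disorderLaw d P₀) := by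
  unfold disorderLaw; infer_instance

theorem disorderLaw_cyl (Λ : Finset (Site d)) (η : Config d H₀) :
    disorderLaw d P₀ (cyl Λ fun x : Λ => η x) = ∏ x ∈ Λ, P₀ {η x} := by
  have : cyl Λ (fun x : Λ => η x) = Set.pi (Λ : Set (Site d)) fun x => {η x} := by
    ext ω; simp [Set.mem_pi]
  rw [this, disorderLaw, Measure.infinitePi_pi _ fun _ _ => measurableSet_singleton _]

theorem indep_disorderLaw (Λ : Finset (Site d)) :
    Indep (sigmaAlg (E := H₀) (Λ : Set (Site d))) (sigmaAlg (Λ : Set (Site d))ᶜ)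
      (disorderLaw d P₀) :=
  indep_iSup_of_disjoint (fun x => (measurable_pi_apply x).comap_le)
    (iIndepFun_infinitePi (P := fun _ : Site d => P₀) (X := fun _ a => a) fun _ => measurable_id)
    disjoint_compl_right

/-- Resampling: on `{η_Λ = a}`, a function of `η_{Λᶜ}` integrates to the product. -/
theorem lintegral_cyl_disorderLaw (Λ : Finset (Site d)) (η₀ : Config d H₀)
    {G : Config d H₀ → ℝ≥0∞} (hG : Measurable[sigmaAlg (Λ : Set (Site d))ᶜ] G) :
    ∫⁻ η, (cyl Λ fun x : Λ => η₀ x).indicator G η ∂(disorderLaw d P₀) =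
      (∏ x ∈ Λ, P₀ {η₀ x}) * ∫⁻ η, G η ∂(disorderLaw d P₀) := by
  have hm := measurableSet_sigmaAlg_cylinder Λ fun x : Λ => η₀ x
  have hi : Measurable[sigmaAlg (Λ : Set (Site d))]
      ((cyl Λ fun x : Λ => η₀ x).indicator fun _ => (1 : ℝ≥0∞)) := by
    refine Measurable.indicator ?_ hm
    exact measurable_const
  have h1 := lintegral_mul_eq_lintegral_mul_lintegral_of_independent_measurableSpace
    cylinderEvents_le_pi cylinderEvents_le_pi (indep_disorderLaw P₀ Λ)
    (f := (cyl Λ fun x : Λ => η₀ x).indicator fun _ => 1)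
    hi hG
  rw [lintegral_indicator_cyl, disorderLaw_cyl] at h1
  rw [← h1]
  refine lintegral_congr fun η => ?_
  by_cases hη : η ∈ cyl Λ fun x : Λ => η₀ x
  · rw [Set.indicator_of_mem hη, Set.indicator_of_mem hη, one_mul]
  · rw [Set.indicator_of_notMem hη, Set.indicator_of_notMem hη, zero_mul]

theorem disorderLaw_map_shift (x : Site d) :
    (disorderLaw d P₀).map (shift x) = disorderLaw d P₀ :=
  Measure.map_infinitePi_infinitePi_of_inj (P := fun _ : Site d => P₀) (add_right_injective x)

end Disorder

/-! ### The joint measures -/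

section Joint

variable {d : ℕ} {H₀ : Finset ℝ} (β h : ℝ) (P₀ : Measure H₀)

/-- The joint configuration with spins `σ` and fields `η`. -/
def join (σ : Config d Bool) (η : Config d H₀) : Config d (Bool × H₀) := fun x => (σ x, η x)

theorem measurable_join {α : Type*} [MeasurableSpace α] {f : α → Config d Bool}
    {g : α → Config d H₀} (hf : Measurable f) (hg : Measurable g) :
    Measurable fun a => join (f a) (g a) :=
  measurable_pi_lambda _ fun x =>
    ((measurable_pi_apply x).comp hf).prodMk ((measurable_pi_apply x).comp hg)

theorem glue_join (Λ : Finset (Site d)) (ζ : Λ → Bool × H₀) (σ : Config d Bool)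
    (η : Config d H₀) :
    glue Λ ζ (join σ η) = join (glue Λ (fun x => (ζ x).1) σ) (glue Λ (fun x => (ζ x).2) η) := by
  funext x
  by_cases hx : x ∈ Λ
  · simp only [join, glue_of_mem _ _ hx]
  · simp only [join, glue_of_notMem _ _ hx]

theorem join_mem_cyl {Λ : Finset (Site d)} {ζ : Λ → Bool × H₀} {σ : Config d Bool}
    {η : Config d H₀} : join σ η ∈ cyl Λ ζ ↔
      σ ∈ cyl Λ (fun x => (ζ x).1) ∧ η ∈ cyl Λ (fun x => (ζ x).2) := by
  simp only [cyl, Set.mem_ofPred_eq, join, Prod.ext_iff, forall_and]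

theorem measurable_jointKernel (hβ : 0 ≤ β) (s : Bool) :
    Measurable fun η : Config d H₀ =>
      (state β h s η : Measure (Config d Bool)).map fun σ x => (σ x, η x) := by
  refine Measure.measurable_of_measurable_coe _ fun t ht => ?_
  have hj : Measurable fun p : Config d H₀ × Config d Bool => join p.2 p.1 :=
    measurable_join measurable_snd measurable_fst
  have := Kernel.measurable_kernel_prodMk_left (κ := stateKernel β h hβ s) (hj ht)
  convert this using 2 with η
  exact Measure.map_apply (measurable_join measurable_id measurable_const) ht

theorem measurable_lintegral_state (hβ : 0 ≤ β) (s : Bool) {α : Type*} [MeasurableSpace α]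
    {g : α → Config d H₀} (hg : Measurable g) {F : α → Config d Bool → ℝ≥0∞}
    (hF : Measurable (Function.uncurry F)) :
    Measurable fun a => ∫⁻ σ, F a σ ∂(state β h s (g a) : Measure (Config d Bool)) :=
  Measurable.lintegral_kernel_prod_right (κ := (stateKernel β h hβ s).comap g hg) hF

/-- The reference field cancels. What remains separates into a factor that depends on the spins but
not on `s`, and a factor that depends on the fields alone. -/
theorem jointWeight_div_jointWeight {P₀ : Measure H₀} (hβ : 0 ≤ β) (hP : ∀ a, 0 < P₀.real {a}) (a₀ : H₀) (s : Bool)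
    (Λ : Finset (Site d)) {σ σ' : Config d Bool} {η η' : Config d H₀}
    (hσ : ∀ x ∉ Λ, σ' x = σ x) (hη : ∀ x ∉ Λ, η' x = η x) :
    jointWeight β h P₀ a₀ s Λ (join σ' η') / jointWeight β h P₀ a₀ s Λ (join σ η) =
      Real.exp (-(energy β h Λ σ' η' - energy β h Λ σ η)) *
        ((∏ x ∈ Λ, P₀.real {η' x}) / ((∏ x ∈ Λ, P₀.real {η x}) * Qfun β h s Λ η' η)) := by
  rw [jointWeight_eq_of_agree β h hβ a₀ s Λ (ξ := join σ η) (ξ' := join σ' η')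
    fun x hx => Prod.ext (hσ x hx) (hη x hx), jointWeight]
  change Real.exp (-energy β h Λ σ' η') * (∏ x ∈ Λ, P₀.real {η' x}) /
    (Qfun β h s Λ η' η * Qfun β h s Λ η (glue Λ (fun _ => a₀) η)) /
    (Real.exp (-energy β h Λ σ η) * (∏ x ∈ Λ, P₀.real {η x}) /
      Qfun β h s Λ η (glue Λ (fun _ => a₀) η)) = _
  have h1 := (Qfun_pos β h s Λ η η').ne'
  have h2 := (Qfun_pos β h s Λ (glue Λ (fun _ => a₀) η) η).ne'
  have h3 : (∏ x ∈ Λ, P₀.real {η x}) ≠ 0 := (Finset.prod_pos fun x _ => hP _).ne'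
  have h4 := (Real.exp_pos (-energy β h Λ σ η)).ne'
  rw [neg_sub, show energy β h Λ σ η - energy β h Λ σ' η' =
    -energy β h Λ σ' η' - -energy β h Λ σ η by ring, Real.exp_sub]
  field_simp

variable [IsProbabilityMeasure P₀]

theorem lintegral_jointMeasure (hβ : 0 ≤ β) (s : Bool) {F : Config d (Bool × H₀) → ℝ≥0∞}
    (hF : Measurable F) :
    ∫⁻ ξ, F ξ ∂(jointMeasure β h P₀ s) =
      ∫⁻ η, ∫⁻ σ, F (join σ η) ∂(state β h s η : Measure (Config d Bool))
        ∂(disorderLaw d P₀) := by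
  rw [jointMeasure, Measure.lintegral_bind (measurable_jointKernel β h hβ s).aemeasurable
    hF.aemeasurable]
  refine lintegral_congr fun η => ?_
  exact lintegral_map hF (measurable_join measurable_id measurable_const)

theorem isProbabilityMeasure_jointMeasure (hβ : 0 ≤ β) (s : Bool) :
    IsProbabilityMeasure (jointMeasure (d := d) β h P₀ s) := ⟨by
  have := lintegral_jointMeasure (d := d) β h P₀ hβ s (F := fun _ => 1) measurable_const
  simpa using this⟩

/-- Covariance of the states turns a shift of the joint configuration into a shift of the fields,
whose law is invariant. -/
theorem jointMeasure_map_shift (hβ : 0 ≤ β) (s : Bool) (x : Site d) :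
    (jointMeasure β h P₀ s).map (shift x) = jointMeasure (d := d) β h P₀ s := by
  refine Measure.ext_of_lintegral _ fun F hF => ?_
  have hFj : ∀ η : Config d H₀, Measurable fun σ => F (join σ η) := fun η =>
    hF.comp (measurable_join measurable_id measurable_const)
  rw [lintegral_map hF (measurable_shift x),
    lintegral_jointMeasure β h P₀ hβ s (F := fun ξ => F (shift x ξ))
      (hF.comp (measurable_shift x)),
    lintegral_jointMeasure β h P₀ hβ s hF]
  conv_rhs => rw [← disorderLaw_map_shift P₀ x]
  have hG : Measurable fun η : Config d H₀ =>
      ∫⁻ σ, F (join σ η) ∂(state β h s η : Measure (Config d Bool)) :=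
    measurable_lintegral_state β h hβ s measurable_id
      (F := fun η σ => F (join σ η)) (hF.comp (measurable_join measurable_snd measurable_fst))
  rw [lintegral_map hG (measurable_shift x)]
  refine lintegral_congr fun η => ?_
  rw [state_shift β h hβ, lintegral_map (hFj _) (measurable_shift x)]
  rfl

variable {P₀}

/-- Detailed balance for the joint measures. -/
theorem lintegral_jointMeasure_detailed_balance (hβ : 0 ≤ β) (hP : ∀ a, 0 < P₀.real {a}) (a₀ : H₀)
    (s : Bool) (Λ : Finset (Site d)) (ζ ζ' : Λ → Bool × H₀) {F : Config d (Bool × H₀) → ℝ≥0∞}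
    (hF : Measurable F) :
    ∫⁻ ξ, (cyl Λ ζ').indicator (fun ξ => F (glue Λ ζ ξ)) ξ ∂(jointMeasure β h P₀ s) =
      ∫⁻ ξ, (cyl Λ ζ).indicator (fun ξ => ENNReal.ofReal (jointWeight β h P₀ a₀ s Λ (glue Λ ζ' ξ) /
        jointWeight β h P₀ a₀ s Λ ξ) * F ξ) ξ ∂(jointMeasure β h P₀ s) := by
  set a : Λ → H₀ := fun x => (ζ x).2
  set a' : Λ → H₀ := fun x => (ζ' x).2
  set τ : Λ → Bool := fun x => (ζ x).1
  set τ' : Λ → Bool := fun x => (ζ' x).1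
  set W := jointWeight β h P₀ a₀ s Λ
  have hW : Measurable W := measurable_jointWeight β h hβ a₀ s Λ
  have hR : Measurable fun ξ => ENNReal.ofReal (W (glue Λ ζ' ξ) / W ξ) * F ξ :=
    ((hW.comp (measurable_glue Λ ζ')).div hW).ennreal_ofReal.mul hF
  have hprod : ∀ η : Config d H₀,
      ∏ x ∈ Λ, P₀ {η x} = ENNReal.ofReal (∏ x ∈ Λ, P₀.real {η x}) := fun η => by
    rw [ENNReal.ofReal_prod_of_nonneg fun x _ => (hP _).le]
    exact Finset.prod_congr rfl fun x _ => (ofReal_measureReal (measure_ne_top _ _)).symm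
  -- the two sides, as integrals of functions of the fields off `Λ`
  let G : Config d H₀ → ℝ≥0∞ := fun η =>
    ∫⁻ σ, (cyl Λ τ').indicator (fun σ => F (join (glue Λ τ σ) (glue Λ a η))) σ
      ∂(state β h s (glue Λ a' η) : Measure (Config d Bool))
  let G' : Config d H₀ → ℝ≥0∞ := fun η =>
    ∫⁻ σ, (cyl Λ τ).indicator (fun σ =>
      ENNReal.ofReal (W (join (glue Λ τ' σ) (glue Λ a' η)) / W (join σ (glue Λ a η))) *
        F (join σ (glue Λ a η))) σ
      ∂(state β h s (glue Λ a η) : Measure (Config d Bool))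
  have hind : ∀ (τ : Λ → Bool) {F : Config d H₀ → Config d Bool → ℝ≥0∞},
      Measurable (Function.uncurry F) →
      Measurable (Function.uncurry fun η σ => (cyl Λ τ).indicator (F η) σ) := by
    intro τ F hF
    have : (Function.uncurry fun η σ => (cyl Λ τ).indicator (F η) σ) =
        (Prod.snd ⁻¹' cyl Λ τ).indicator (Function.uncurry F) := rfl
    rw [this]
    exact hF.indicator (measurable_snd (measurableSet_cylinder Λ τ))
  have hGm : Measurable[sigmaAlg (Λ : Set (Site d))ᶜ] G := by
    refine measurable_sigmaAlg_compl Λ a ?_ fun η => by simp only [G, glue_glue]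
    exact measurable_lintegral_state β h hβ s (measurable_glue Λ a') (hind τ'
      (F := fun η σ => F (join (glue Λ τ σ) (glue Λ a η)))
      (hF.comp (measurable_join ((measurable_glue Λ τ).comp measurable_snd)
        ((measurable_glue Λ a).comp measurable_fst))))
  have hGm' : Measurable[sigmaAlg (Λ : Set (Site d))ᶜ] G' := by
    refine measurable_sigmaAlg_compl Λ a ?_ fun η => by simp only [G', glue_glue]
    have hj1 := measurable_join (H₀ := H₀) ((measurable_glue Λ τ').comp measurable_snd)
        ((measurable_glue Λ a').comp measurable_fst)
    have hj2 := measurable_join (H₀ := H₀) (measurable_snd (α := Config d H₀) (β := Config d Bool))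
        ((measurable_glue Λ a).comp measurable_fst)
    exact measurable_lintegral_state β h hβ s (measurable_glue Λ a) (hind τ (F := fun η σ =>
      ENNReal.ofReal (W (join (glue Λ τ' σ) (glue Λ a' η)) / W (join σ (glue Λ a η))) *
        F (join σ (glue Λ a η)))
      (((hW.comp hj1).div (hW.comp hj2)).ennreal_ofReal.mul (hF.comp hj2)))
  -- On the event that the fields in `Λ` are `a'`, overwriting them by `a'` changes nothing, so the
  -- integrand may be replaced by a function of the fields off `Λ`.
  have hleft : ∫⁻ ξ, (cyl Λ ζ').indicator (fun ξ => F (glue Λ ζ ξ)) ξ ∂(jointMeasure β h P₀ s) =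
      ∫⁻ η, (cyl Λ a').indicator G η ∂(disorderLaw d P₀) := by
    rw [lintegral_jointMeasure β h P₀ hβ s
      (F := (cyl Λ ζ').indicator fun ξ => F (glue Λ ζ ξ)) ((hF.comp (measurable_glue Λ ζ)).indicator (measurableSet_cylinder Λ ζ'))]
    refine lintegral_congr fun η => ?_
    by_cases hη : η ∈ cyl Λ a'
    · rw [Set.indicator_of_mem hη]
      simp only [G]
      rw [glue_eq_self hη]
      refine lintegral_congr fun σ => ?_
      by_cases hσ : σ ∈ cyl Λ τ'
      · rw [Set.indicator_of_mem hσ, Set.indicator_of_mem (join_mem_cyl.2 ⟨hσ, hη⟩), glue_join]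
      · rw [Set.indicator_of_notMem hσ,
          Set.indicator_of_notMem fun hm => hσ (join_mem_cyl.1 hm).1]
    · rw [Set.indicator_of_notMem hη]
      refine (lintegral_congr fun σ => ?_).trans lintegral_zero
      exact Set.indicator_of_notMem (fun hm => hη (join_mem_cyl.1 hm).2) _
  have hright : ∫⁻ ξ, (cyl Λ ζ).indicator (fun ξ =>
        ENNReal.ofReal (W (glue Λ ζ' ξ) / W ξ) * F ξ) ξ ∂(jointMeasure β h P₀ s) =
      ∫⁻ η, (cyl Λ a).indicator G' η ∂(disorderLaw d P₀) := by
    rw [lintegral_jointMeasure β h P₀ hβ s (hR.indicator (measurableSet_cylinder Λ ζ))]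
    refine lintegral_congr fun η => ?_
    by_cases hη : η ∈ cyl Λ a
    · rw [Set.indicator_of_mem hη]
      simp only [G']
      rw [glue_eq_self hη]
      refine lintegral_congr fun σ => ?_
      by_cases hσ : σ ∈ cyl Λ τ
      · rw [Set.indicator_of_mem hσ, Set.indicator_of_mem (join_mem_cyl.2 ⟨hσ, hη⟩), glue_join]
      · rw [Set.indicator_of_notMem hσ,
          Set.indicator_of_notMem fun hm => hσ (join_mem_cyl.1 hm).1]
    · rw [Set.indicator_of_notMem hη]
      refine (lintegral_congr fun σ => ?_).trans lintegral_zero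
      exact Set.indicator_of_notMem (fun hm => hη (join_mem_cyl.1 hm).2) _
  have ha : ∀ (b : Λ → H₀) (η : Config d H₀), cyl Λ b = cyl Λ fun x : Λ => glue Λ b η x :=
    fun b η => by simp only [glue_mem_cylinder]
  -- An arbitrary background, needed only to present `a` and `a'` as restrictions of full
  -- configurations. Independence then replaces the two field events by their probabilities, and the
  -- identity may be checked for each `η`.
  let η₀ : Config d H₀ := fun _ => a₀
  rw [hleft, hright, ha a η₀, ha a' η₀, lintegral_cyl_disorderLaw P₀ Λ _ hGm,
    lintegral_cyl_disorderLaw P₀ Λ _ hGm', ← lintegral_const_mul _ (hGm.mono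
      cylinderEvents_le_pi le_rfl), ← lintegral_const_mul _ (hGm'.mono cylinderEvents_le_pi le_rfl)]
  refine lintegral_congr fun η => ?_
  have hsame : ∀ b : Λ → H₀, ∏ x ∈ Λ, P₀ {glue Λ b η₀ x} = ∏ x ∈ Λ, P₀ {glue Λ b η x} := fun b =>
    Finset.prod_congr rfl fun x hx => by rw [glue_of_mem _ _ hx, glue_of_mem _ _ hx]
  rw [hsame, hsame, hprod, hprod]
  set p := ∏ x ∈ Λ, P₀.real {glue Λ a η x}
  set p' := ∏ x ∈ Λ, P₀.real {glue Λ a' η x}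
  have hp : 0 < p := Finset.prod_pos fun x _ => hP _
  have hp' : 0 < p' := Finset.prod_pos fun x _ => hP _
  have hagree : ∀ x ∉ Λ, glue Λ a' η x = glue Λ a η x := fun x hx => by
    rw [glue_of_notMem _ _ hx, glue_of_notMem _ _ hx]
  have hQ := Qfun_pos β h s Λ (glue Λ a η) (glue Λ a' η)
  set q := Qfun β h s Λ (glue Λ a' η) (glue Λ a η)
  have hFj : Measurable fun σ => F (join σ (glue Λ a η)) :=
    hF.comp (measurable_join measurable_id measurable_const)
  have hdb := lintegral_state_detailed_balance β h hβ s Λ hagree τ τ' hFj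
  -- Quenched detailed balance; `p' / (p * q)` is the spin-free part of the weight ratio. With the
  -- probability `p` in front, the total factor is `p * (p' / (p * q)) * q = p'`.
  have hG' : G' η = ENNReal.ofReal (p' / (p * q)) * (ENNReal.ofReal q * G η) := by
    change _ = _ * (_ * ∫⁻ σ, _ ∂_)
    rw [hdb, ← lintegral_const_mul' _ _ ENNReal.ofReal_ne_top]
    refine lintegral_congr fun σ => ?_
    by_cases hσ : σ ∈ cyl Λ τ
    · rw [Set.indicator_of_mem hσ, Set.indicator_of_mem hσ, jointWeight_div_jointWeight β h hβ hP
        a₀ s Λ (fun x hx => glue_of_notMem _ _ hx) hagree, ← mul_assoc,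
        ENNReal.ofReal_mul (Real.exp_pos _).le, mul_comm (ENNReal.ofReal (p' / (p * q)))]
    · rw [Set.indicator_of_notMem hσ, Set.indicator_of_notMem hσ, mul_zero]
  rw [hG', ← mul_assoc, ← mul_assoc, ← ENNReal.ofReal_mul hp.le,
    ← ENNReal.ofReal_mul (mul_pos hp (div_pos hp' (mul_pos hp hQ))).le]
  congr 2
  field_simp

/-- Splitting an integral according to the configuration in `Λ`. -/
theorem sum_lintegral_cyl {E : Type} [Fintype E] [MeasurableSpace E] [MeasurableSingletonClass E]
    (μ : Measure (Config d E)) (Λ : Finset (Site d)) {F : Config d E → ℝ≥0∞} (hF : Measurable F) :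
    ∑ ζ : Λ → E, ∫⁻ ξ, (cyl Λ ζ).indicator F ξ ∂μ = ∫⁻ ξ, F ξ ∂μ := by
  rw [← lintegral_finsetSum _ fun ζ _ => hF.indicator (measurableSet_cylinder Λ ζ)]
  refine lintegral_congr fun ξ => ?_
  rw [Finset.sum_eq_single fun x : Λ => ξ x]
  · exact Set.indicator_of_mem (mem_cyl_restrict Λ ξ) _
  · intro ζ _ hζ
    exact Set.indicator_of_notMem (fun hm => hζ (mem_cyl_iff.1 hm).symm) _
  · exact fun hn => (hn (Finset.mem_univ _)).elim

/-- The joint measure `K^s` is invariant under the kernels of its specification. -/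
theorem lintegral_gibbsKernel_jointMeasure (hβ : 0 ≤ β) (hP : ∀ a, 0 < P₀.real {a}) (a₀ : H₀)
    (s : Bool) (Λ : Finset (Site d)) {A : Set (Config d (Bool × H₀))} (hA : MeasurableSet A) :
    ∫⁻ ξ, gibbsKernel (jointWeight β h P₀ a₀ s) Λ ξ A ∂(jointMeasure β h P₀ s) =
      jointMeasure β h P₀ s A := by
  set K := jointMeasure (d := d) β h P₀ s
  set W := jointWeight (d := d) β h P₀ a₀ s with hWdef
  have hW : Measurable (W Λ) := measurable_jointWeight β h hβ a₀ s Λ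
  have hWpos : ∀ Λ ξ, 0 < W Λ ξ := jointWeight_pos β h hP a₀ s
  let F : Config d (Bool × H₀) → ℝ≥0∞ := fun ξ =>
    ENNReal.ofReal (W Λ ξ / ∑ ξ' ∈ confs Λ ξ, W Λ ξ') * A.indicator 1 ξ
  have hZm : Measurable fun ξ => ∑ ξ' ∈ confs Λ ξ, W Λ ξ' := by
    simp only [sum_confs]
    exact Finset.measurable_sum _ fun ζ _ => hW.comp (measurable_glue Λ ζ)
  have hF : Measurable F :=
    (hW.div hZm).ennreal_ofReal.mul (measurable_one.indicator hA)
  have hker : ∀ ξ, gibbsKernel W Λ ξ A = ∑ ζ : Λ → Bool × H₀, F (glue Λ ζ ξ) := by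
    intro ξ
    rw [gibbsKernel_apply Λ ξ hA, sum_confs]
    refine Finset.sum_congr rfl fun ζ _ => ?_
    simp only [F]
    rw [confs_eq_of_mem fun x hx => glue_of_notMem ζ ξ hx]
  calc ∫⁻ ξ, gibbsKernel W Λ ξ A ∂K
      = ∑ ζ : Λ → Bool × H₀, ∫⁻ ξ, F (glue Λ ζ ξ) ∂K := by
        simp only [hker]
        exact lintegral_finsetSum _ fun ζ _ => hF.comp (measurable_glue Λ ζ)
    _ = ∑ ζ : Λ → Bool × H₀, ∑ ζ' : Λ → Bool × H₀,
          ∫⁻ ξ, (cyl Λ ζ').indicator (fun ξ => F (glue Λ ζ ξ)) ξ ∂K :=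
        Finset.sum_congr rfl fun ζ _ =>
          (sum_lintegral_cyl K Λ (hF.comp (measurable_glue Λ ζ))).symm
    _ = ∑ ζ : Λ → Bool × H₀, ∑ ζ' : Λ → Bool × H₀,
          ∫⁻ ξ, (cyl Λ ζ).indicator
            (fun ξ => ENNReal.ofReal (W Λ (glue Λ ζ' ξ) / W Λ ξ) * F ξ) ξ ∂K :=
        Finset.sum_congr rfl fun ζ _ => Finset.sum_congr rfl fun ζ' _ =>
          lintegral_jointMeasure_detailed_balance β h hβ hP a₀ s Λ ζ ζ' hF
    _ = ∑ ζ : Λ → Bool × H₀, ∫⁻ ξ, (cyl Λ ζ).indicator (A.indicator 1) ξ ∂K := by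
        -- Multiplied by the kernel weight inside `F`, the ratios become the kernel weights of all
        -- the configurations `glue Λ ζ' ξ`, which sum to one.
        refine Finset.sum_congr rfl fun ζ _ => ?_
        rw [← lintegral_finsetSum (f := fun ζ' => (cyl Λ ζ).indicator fun ξ =>
          ENNReal.ofReal (W Λ (glue Λ ζ' ξ) / W Λ ξ) * F ξ) _ fun ζ' _ =>
          ((((hW.comp (measurable_glue Λ ζ')).div hW).ennreal_ofReal.mul hF).indicator
            (measurableSet_cylinder Λ ζ))]
        refine lintegral_congr fun ξ => ?_
        by_cases hξ : ξ ∈ cyl Λ ζ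
        · simp only [Set.indicator_of_mem hξ]
          have hterm : ∀ ζ' : Λ → Bool × H₀,
              ENNReal.ofReal (W Λ (glue Λ ζ' ξ) / W Λ ξ) * F ξ =
              ENNReal.ofReal (W Λ (glue Λ ζ' ξ) / ∑ ξ' ∈ confs Λ ξ, W Λ ξ') *
                A.indicator 1 ξ := by
            intro ζ'
            simp only [F]
            rw [← mul_assoc, ← ENNReal.ofReal_mul (div_pos (hWpos _ _) (hWpos _ _)).le,
              div_mul_div_cancel₀ (hWpos Λ ξ).ne']
          rw [Finset.sum_congr rfl fun ζ' _ => hterm ζ', ← Finset.sum_mul,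
            ← sum_confs Λ ξ fun ξ'' => ENNReal.ofReal (W Λ ξ'' / ∑ ξ' ∈ confs Λ ξ, W Λ ξ'),
            sum_gibbs_weights hWpos, one_mul]
        · simp only [Set.indicator_of_notMem hξ, Finset.sum_const_zero]
    _ = K A := by
        rw [sum_lintegral_cyl K Λ (measurable_one.indicator hA), lintegral_indicator_one hA]

/-- Invariance under the kernel, applied to `B ∩ A`, together with properness on `B` gives the
integral identity that characterizes the conditional expectation. -/
theorem jointMeasure_mem_consistentMeasures (hβ : 0 ≤ β) (hP : ∀ a, 0 < P₀.real {a}) (a₀ : H₀)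
    (s : Bool) :
    jointMeasure (d := d) β h P₀ s ∈ consistentMeasures (jointSpec β h P₀ s) := by
  have hprob := isProbabilityMeasure_jointMeasure (d := d) β h P₀ hβ s
  rw [jointSpec_eq_gibbsKernel β h hβ hP a₀]
  have : Nonempty H₀ := ⟨a₀⟩
  have hspec : IsSpecification (gibbsKernel (jointWeight (d := d) β h P₀ a₀ s)) :=
    isSpecification_gibbsKernel (jointWeight_pos β h hP a₀ s)
      (measurable_jointWeight β h hβ a₀ s) (isCompatible_jointWeight β h hβ a₀ s)
  set γ := gibbsKernel (jointWeight (d := d) β h P₀ a₀ s) with hγ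
  refine ⟨hprob, fun Λ A hA => ?_⟩
  have hle : sigmaAlg (E := Bool × H₀) (Λ : Set (Site d))ᶜ ≤ MeasurableSpace.pi :=
    cylinderEvents_le_pi
  have hmeas : Measurable[sigmaAlg (Λ : Set (Site d))ᶜ] fun ξ => (γ Λ ξ).real A :=
    (hspec.measurable Λ A hA).ennreal_toReal
  have hbd : ∀ ξ, ‖(γ Λ ξ).real A‖ ≤ 1 := fun ξ => by
    have := hspec.isProb Λ ξ
    rw [Real.norm_of_nonneg measureReal_nonneg]
    exact measureReal_le_one
  have hint : Integrable (fun ξ => (γ Λ ξ).real A) (jointMeasure (d := d) β h P₀ s) :=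
    Integrable.of_bound (hmeas.mono hle le_rfl).aestronglyMeasurable 1
      (Eventually.of_forall hbd)
  refine (ae_eq_condExp_of_forall_setIntegral_eq hle
    ((integrable_const (1 : ℝ)).indicator hA) (fun B _ _ => hint.integrableOn) (fun B hB _ => ?_)
    hmeas.stronglyMeasurable.aestronglyMeasurable).symm
  have hBm : MeasurableSet B := hle _ hB
  rw [setIntegral_indicator hA, setIntegral_const, smul_eq_mul, mul_one,
    integral_eq_lintegral_of_nonneg_ae (Eventually.of_forall fun _ => measureReal_nonneg)
      hint.aestronglyMeasurable.restrict, measureReal_def]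
  congr 1
  rw [← lintegral_gibbsKernel_jointMeasure β h hβ hP a₀ s Λ (hBm.inter hA),
    ← lintegral_indicator hBm]
  refine lintegral_congr fun ξ => ?_
  have hp := hspec.isProb Λ ξ
  have hprop := hspec.proper Λ B hB ξ
  by_cases hξ : ξ ∈ B
  · rw [Set.indicator_of_mem hξ] at hprop ⊢
    rw [ofReal_measureReal (measure_ne_top _ _)]
    have hae : ∀ᵐ ξ' ∂(γ Λ ξ), ξ' ∈ B := (prob_compl_eq_zero_iff hBm).2 hprop
    refine measure_congr ?_
    filter_upwards [hae] with ξ' hξ'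
    exact propext ⟨fun hx => ⟨hξ', hx⟩, fun hx => hx.2⟩
  · rw [Set.indicator_of_notMem hξ] at hprop ⊢
    exact (measure_mono_null Set.inter_subset_left hprop).symm

end Joint

end RandomField

namespace RandomField

/-! ### The joint measures have no common specification of finite range in the spins -/

section NoCommonSpecification

variable {d : ℕ} {H₀ : Finset ℝ} (β h : ℝ)

/-- The function `Q` of a single site is determined by the magnetization. -/
theorem Qfun_singleton (s : Bool) (x : Site d) (η η' : Config d H₀) :
    Qfun β h s {x} η' η = Real.exp (-(h * ((η' x : ℝ) - η x))) +
      (Real.exp (h * ((η' x : ℝ) - η x)) - Real.exp (-(h * ((η' x : ℝ) - η x)))) *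
        (state β h s η : Measure (Config d Bool)).real (allEq {x} true) := by
  have hint := integrable_of_continuous (state β h s η : Measure (Config d Bool))
    (continuous_allEqInd {x} true)
  have hpt : ∀ σ : Config d Bool,
      Real.exp (-(energy β h {x} σ η' - energy β h {x} σ η)) =
      Real.exp (-(h * ((η' x : ℝ) - η x))) + (Real.exp (h * ((η' x : ℝ) - η x)) -
        Real.exp (-(h * ((η' x : ℝ) - η x)))) * allEqInd {x} true σ := by
    intro σ
    rw [energy_sub_energy_field, Finset.sum_singleton, neg_neg]
    cases hσ : σ x
    · rw [allEqInd_of_notMem (by simp [allEq, hσ])]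
      simp [spinVal]
    · rw [allEqInd_of_mem (by simp [allEq, hσ])]
      simp [spinVal]
  rw [Qfun]
  simp only [hpt]
  rw [integral_add (integrable_const _) (hint.const_mul _), integral_const_mul,
    integral_allEqInd]
  simp

/-- The slope is `2 sinh (h (η' x - η x))`, which vanishes only if `h = 0` or the fields at `x`
coincide. -/
theorem real_eq_of_Qfun_singleton_eq (hh : h ≠ 0) {s s' : Bool} {x : Site d} {η η' : Config d H₀}
    (hx : η' x ≠ η x) (hQ : Qfun β h s {x} η' η = Qfun β h s' {x} η' η) :
    (state β h s η : Measure (Config d Bool)).real (allEq {x} true) =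
      (state β h s' η : Measure (Config d Bool)).real (allEq {x} true) := by
  rw [Qfun_singleton, Qfun_singleton] at hQ
  refine mul_left_cancel₀ ?_ (add_left_cancel hQ)
  intro h0
  have h1 := Real.exp_injective (sub_eq_zero.1 h0)
  have h2 : h * ((η' x : ℝ) - η x) = 0 := by linarith
  rcases mul_eq_zero.1 h2 with h3 | h3
  · exact hh h3
  · exact hx (Subtype.ext (sub_eq_zero.1 h3))

variable {P₀ : Measure H₀}

/-- Two outcomes at `x` with equal spin and different fields have a probability ratio in which only
`Qfun` depends on the boundary sign. -/
theorem Qfun_eq_of_jointSpec_eq (hβ : 0 ≤ β) (hP : ∀ a, 0 < P₀.real {a}) (a₀ : H₀)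
    (x : Site d) {η η' : Config d H₀} (hη : ∀ y ∉ ({x} : Finset (Site d)), η' y = η y)
    (σ : Config d Bool) {s s' : Bool}
    (heq : ∀ ζ : ({x} : Finset (Site d)) → Bool × H₀,
      (jointSpec β h P₀ s {x} (join σ η)).real (cyl {x} ζ) =
        (jointSpec β h P₀ s' {x} (join σ η)).real (cyl {x} ζ)) :
    Qfun β h s {x} η' η = Qfun β h s' {x} η' η := by
  have hWpos := fun s => jointWeight_pos (d := d) β h hP a₀ s
  have hratio : ∀ s, (jointSpec β h P₀ s {x} (join σ η)).real (cyl {x} fun y => join σ η' y) /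
      (jointSpec β h P₀ s {x} (join σ η)).real (cyl {x} fun y => join σ η y) =
      (∏ y ∈ {x}, P₀.real {η' y}) / ((∏ y ∈ {x}, P₀.real {η y}) * Qfun β h s {x} η' η) *
        Real.exp (-(energy β h {x} σ η' - energy β h {x} σ η)) := by
    intro s
    have hg : glue {x} (fun y : ({x} : Finset (Site d)) => join σ η' y) (join σ η) =
        join σ η' := by
      rw [glue_congr (ω' := join σ η') _ fun y hy =>
        show join σ η y = join σ η' y from Prod.ext rfl (hη y hy).symm]
      exact glue_restrict _ _
    rw [jointSpec_eq_gibbsKernel β h hβ hP a₀, gibbsKernel_real_cyl (hWpos s),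
      gibbsKernel_real_cyl (hWpos s), div_div_div_cancel_right₀
        (sum_confs_pos (hWpos s) {x} (join σ η)).ne', hg, glue_restrict,
      jointWeight_div_jointWeight β h hβ hP a₀ s {x} (fun _ _ => rfl) hη, mul_comm]
  have h1 := (hratio s).symm.trans ((by rw [heq, heq]) : _ = _) |>.trans (hratio s')
  have hp : ∀ η : Config d H₀, (∏ y ∈ {x}, P₀.real {η y}) ≠ 0 := fun η =>
    (Finset.prod_pos fun y _ => hP _).ne'
  have h2 := mul_right_cancel₀ (Real.exp_pos _).ne' h1
  rw [div_eq_div_iff (mul_ne_zero (hp η) (Qfun_pos β h s {x} η η').ne')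
    (mul_ne_zero (hp η) (Qfun_pos β h s' {x} η η').ne')] at h2
  exact (mul_left_cancel₀ (hp η) (mul_left_cancel₀ (hp η') h2)).symm

variable [IsProbabilityMeasure P₀]

/-- A failure at one `σ` would spread to a whole spin cylinder, which has positive probability. The
exceptional set then concerns only the disorder law, which is shared by both joint measures. -/
theorem ae_forall_of_ae_jointMeasure (hβ : 0 ≤ β) (s : Bool)
    {p : Config d (Bool × H₀) → Prop} (hp : ∀ᵐ ξ ∂(jointMeasure β h P₀ s), p ξ)
    (hloc : ∃ Δ : Finset (Site d), ∀ ξ ξ' : Config d (Bool × H₀), fields ξ = fields ξ' →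
      (∀ x ∈ Δ, spins ξ x = spins ξ' x) → p ξ → p ξ') :
    ∀ᵐ η ∂(disorderLaw d P₀), ∀ σ, p (join σ η) := by
  obtain ⟨Δ, hΔ⟩ := hloc
  have h1 := Measure.ae_ae_of_ae_bind (measurable_jointKernel β h hβ s).aemeasurable hp
  filter_upwards [h1] with η hη σ
  have hη' : ∀ᵐ σ ∂(state β h s η : Measure (Config d Bool)), p (join σ η) :=
    ae_of_ae_map (measurable_join measurable_id measurable_const).aemeasurable hη
  by_contra hσ
  have hsub : cyl Δ (fun x : Δ => σ x) ⊆ {σ' | ¬ p (join σ' η)} := fun σ' hσ' hp' =>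
    hσ (hΔ (join σ' η) (join σ η) rfl (fun x hx => hσ' ⟨x, hx⟩) hp')
  exact (state_cyl_pos β h hβ s η Δ _).ne' (measure_mono_null hsub (ae_iff.1 hη'))

theorem ae_real_eq_of_consistent {μ : Measure (Config d (Bool × H₀))}
    {γ γ' : KernelFamily d (Bool × H₀)} (hγ : μ ∈ consistentMeasures γ)
    (hγ' : μ ∈ consistentMeasures γ') (Λ : Finset (Site d)) {A : Set (Config d (Bool × H₀))}
    (hA : MeasurableSet A) : ∀ᵐ ξ ∂μ, (γ Λ ξ).real A = (γ' Λ ξ).real A :=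
  (hγ.2 Λ A hA).symm.trans (hγ'.2 Λ A hA)

/-- A specification of finite range in the spins that is consistent with `K^s` agrees with `γ^s` on
local events, for almost every field and every spin configuration. -/
theorem ae_forall_real_eq_jointSpec (hβ : 0 ≤ β) (hP : ∀ a, 0 < P₀.real {a}) (a₀ : H₀) (s : Bool)
    {γ : KernelFamily d (Bool × H₀)} (hγ : HasFiniteSpinRange γ)
    (hK : jointMeasure β h P₀ s ∈ consistentMeasures γ) (Λ : Finset (Site d))
    {A : Set (Config d (Bool × H₀))} (hA : MeasurableSet[sigmaAlg (Λ : Set (Site d))] A) :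
    ∀ᵐ η ∂(disorderLaw d P₀), ∀ σ,
      (γ Λ (join σ η)).real A = (jointSpec β h P₀ s Λ (join σ η)).real A := by
  classical
  refine ae_forall_of_ae_jointMeasure β h hβ s
    (p := fun ξ => (γ Λ ξ).real A = (jointSpec β h P₀ s Λ ξ).real A)
    (ae_real_eq_of_consistent hK (jointMeasure_mem_consistentMeasures β h hβ hP a₀ s) Λ
      (cylinderEvents_le_pi _ hA)) ?_
  obtain ⟨Δ, hΔ⟩ := hγ Λ A hA
  obtain ⟨Δ', hΔ'⟩ := hasFiniteSpinRange_jointSpec β h hβ hP a₀ s Λ A hA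
  refine ⟨Δ ∪ Δ', fun ξ ξ' hf hs hp => ?_⟩
  rw [measureReal_def, measureReal_def] at hp ⊢
  rwa [← hΔ ξ ξ' hf fun x hx => hs x (Finset.mem_union_left _ hx),
    ← hΔ' ξ ξ' hf fun x hx => hs x (Finset.mem_union_right _ hx)]

theorem not_consistent_both [Nontrivial H₀] (hβ : 0 ≤ β) (hh : h ≠ 0)
    (hP : ∀ a, 0 < P₀.real {a})
    (hphase : ∀ᵐ η ∂(disorderLaw d P₀), ∃ x : Site d,
      (state β h false η : Measure (Config d Bool)) {σ | σ x = true} <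
        (state β h true η : Measure (Config d Bool)) {σ | σ x = true})
    {γ : KernelFamily d (Bool × H₀)} (hγ : HasFiniteSpinRange γ) :
    ¬ (jointMeasure β h P₀ true ∈ consistentMeasures γ ∧
        jointMeasure β h P₀ false ∈ consistentMeasures γ) := by
  classical
  rintro ⟨hplus, hminus⟩
  obtain ⟨a₀, -⟩ := exists_pair_ne H₀
  have hall : ∀ (x : Site d) (ζ : ({x} : Finset (Site d)) → Bool × H₀),
      ∀ᵐ η ∂(disorderLaw d P₀), ∀ σ,
        (jointSpec β h P₀ true {x} (join σ η)).real (cyl {x} ζ) =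
          (jointSpec β h P₀ false {x} (join σ η)).real (cyl {x} ζ) := by
    intro x ζ
    have hA := measurableSet_sigmaAlg_cylinder {x} ζ
    filter_upwards [ae_forall_real_eq_jointSpec β h hβ hP a₀ true hγ hplus {x} hA,
      ae_forall_real_eq_jointSpec β h hβ hP a₀ false hγ hminus {x} hA] with η h1 h2 σ
    rw [← h1, h2]
  -- There are countably many sites and finitely many local outcomes, so one null set of fields
  -- serves all of them.
  have hall' := ae_all_iff.2 fun x => ae_all_iff.2 (hall x)
  obtain ⟨η, h1, x, hx⟩ := (hall'.and hphase).exists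
  -- A second field value at the site where the magnetizations differ; the fields elsewhere are
  -- kept.
  obtain ⟨b, hb⟩ := exists_ne (η x)
  have hx' : (Function.update η x b) x ≠ η x := by rwa [Function.update_self]
  have hQ := Qfun_eq_of_jointSpec_eq β h hβ hP a₀ x (η := η) (η' := Function.update η x b)
    (fun y hy => Function.update_of_ne (by simpa using hy) _ _) (fun _ => true)
    fun ζ => h1 x ζ (fun _ => true)
  have hreal := real_eq_of_Qfun_singleton_eq β h hh hx' hQ
  have hset : allEq {x} true = {σ : Config d Bool | σ x = true} := by
    ext σ; simp [allEq]
  rw [hset] at hreal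
  exact hx.ne ((measureReal_eq_measureReal_iff).1 hreal).symm

end NoCommonSpecification

/-! ### The relative entropy density -/

section Entropy

/-- On a finite space the pointwise bound says that the density is at most `exp c`, so the
log-likelihood ratio is at most `c` almost surely, and so is its mean. -/
theorem klDiv_le_of_forall_singleton_le {α : Type*} [Finite α] [MeasurableSpace α]
    [MeasurableSingletonClass α] (μ ν : Measure α) [IsProbabilityMeasure μ]
    [IsProbabilityMeasure ν] {c : ℝ} (hc : 0 ≤ c)
    (hμν : ∀ a, μ {a} ≤ ENNReal.ofReal (Real.exp c) * ν {a}) :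
    InformationTheory.klDiv μ ν ≤ ENNReal.ofReal c := by
  have hac : μ ≪ ν := by
    refine Measure.AbsolutelyContinuous.mk fun t _ ht => ?_
    rw [← Set.biUnion_of_singleton t, measure_biUnion_null_iff t.to_countable]
    intro a ha
    have h0 : ν {a} = 0 := measure_mono_null (Set.singleton_subset_iff.2 ha) ht
    have := hμν a
    rwa [h0, mul_zero, nonpos_iff_eq_zero] at this
  have hle : ∀ᵐ a ∂μ, llr μ ν a ≤ c := by
    rw [ae_iff_of_countable]
    intro a ha
    have hν : ν {a} ≠ 0 := fun h0 => ha (hac h0)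
    have h1 : μ.rnDeriv ν a * ν {a} = μ {a} := by
      rw [← Measure.setLIntegral_rnDeriv hac {a}, lintegral_singleton]
    have h2 : μ.rnDeriv ν a ≤ ENNReal.ofReal (Real.exp c) := by
      have := hμν a
      rwa [← h1, ENNReal.mul_le_mul_iff_left hν (measure_ne_top _ _)] at this
    have h3 : (μ.rnDeriv ν a).toReal ≤ Real.exp c :=
      ENNReal.toReal_le_of_le_ofReal (Real.exp_pos c).le h2
    rw [llr_def]
    rcases (ENNReal.toReal_nonneg (a := μ.rnDeriv ν a)).eq_or_lt with h4 | h4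
    -- Where the density has real value zero, `Real.log 0 = 0` is still at most `c`.
    · simpa [← h4] using hc
    · exact (Real.log_le_iff_le_exp h4).2 h3
  have hint : Integrable (llr μ ν) μ := Integrable.of_finite
  rw [InformationTheory.klDiv_of_ac_of_integrable hac hint]
  refine ENNReal.ofReal_le_ofReal ?_
  have h1 : ∫ a, llr μ ν a ∂μ ≤ ∫ _, c ∂μ := integral_mono_ae hint (integrable_const c) hle
  simp only [probReal_univ, integral_const, one_smul] at h1 ⊢
  linarith

/-! ### Boundary estimates and the entropy density of the joint measures. -/

variable {d : ℕ} {H₀ : Finset ℝ} (β h : ℝ)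

/-- The base points of the bonds in direction `i` with exactly one endpoint in `Λ`. -/
noncomputable def boundaryBonds (Λ : Finset (Site d)) (i : Fin d) : Finset (Site d) :=
  (bonds Λ i).filter fun x => ¬ (x ∈ Λ ∧ x + Pi.single i 1 ∈ Λ)

/-- The total interaction through the boundary of `Λ`. -/
noncomputable def boundaryConst (Λ : Finset (Site d)) : ℝ :=
  2 * |β| * ∑ i : Fin d, ((boundaryBonds Λ i).card : ℝ)

theorem boundaryConst_nonneg (Λ : Finset (Site d)) : 0 ≤ boundaryConst β Λ :=
  mul_nonneg (mul_nonneg zero_le_two (abs_nonneg _))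
    (Finset.sum_nonneg fun _ _ => Nat.cast_nonneg _)

/-- The boundary condition changes the energy by at most a boundary term. -/
theorem abs_energy_glue_sub_le (Λ : Finset (Site d)) (τ : Λ → Bool) (σ σ' : Config d Bool)
    (η : Config d H₀) :
    |energy β h Λ (glue Λ τ σ) η - energy β h Λ (glue Λ τ σ') η| ≤ boundaryConst β Λ := by
  have hin : ∀ x ∈ Λ, glue Λ τ σ x = glue Λ τ σ' x := fun x hx => by
    rw [glue_of_mem _ _ hx, glue_of_mem _ _ hx]
  have hfield : ∑ x ∈ Λ, -(h * (η x : ℝ) * spinVal (glue Λ τ σ x)) =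
      ∑ x ∈ Λ, -(h * (η x : ℝ) * spinVal (glue Λ τ σ' x)) :=
    Finset.sum_congr rfl fun x hx => by rw [hin x hx]
  rw [energy_eq, energy_eq, hfield, add_sub_add_right_eq_sub, ← Finset.sum_sub_distrib,
    boundaryConst, Finset.mul_sum]
  refine (Finset.abs_sum_le_sum_abs _ _).trans (Finset.sum_le_sum fun i _ => ?_)
  rw [← Finset.sum_sub_distrib, boundaryBonds, mul_comm, ← nsmul_eq_mul, ← Finset.sum_const,
    Finset.sum_filter]
  refine (Finset.abs_sum_le_sum_abs _ _).trans (Finset.sum_le_sum fun x _ => ?_)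
  split_ifs with hx
  · rw [hin _ hx.1, hin _ hx.2, sub_self, abs_zero]
  · refine (abs_sub _ _).trans (le_of_eq ?_)
    simp only [abs_neg, abs_mul, abs_spinVal]
    ring

theorem sum_measure_cyl {E : Type} [Fintype E] [MeasurableSpace E] [MeasurableSingletonClass E]
    (μ : Measure (Config d E)) [IsProbabilityMeasure μ] (Λ : Finset (Site d)) :
    ∑ ζ : Λ → E, μ (cyl Λ ζ) = 1 := by
  have := sum_lintegral_cyl μ Λ (F := fun _ => 1) measurable_const
  simpa only [lintegral_indicator_cyl, lintegral_one, measure_univ] using this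

/-- This is detailed balance at equal fields. The exterior is replaced by the fixed `σ₀` in two
energies, each at the cost of one `boundaryConst`; the remaining energy difference no longer depends
on the state. -/
theorem state_cyl_le_mul_state_cyl (hβ : 0 ≤ β) (s : Bool) (η : Config d H₀)
    (Λ : Finset (Site d)) (τ τ' : Λ → Bool) (σ₀ : Config d Bool) :
    (state β h s η : Measure (Config d Bool)) (cyl Λ τ') ≤
      ENNReal.ofReal (Real.exp (energy β h Λ (glue Λ τ σ₀) η - energy β h Λ (glue Λ τ' σ₀) η +
        2 * boundaryConst β Λ)) * (state β h s η : Measure (Config d Bool)) (cyl Λ τ) := by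
  have hdb := lintegral_state_detailed_balance β h hβ s Λ (η := η) (η' := η)
    (fun _ _ => rfl) τ τ' (F := fun _ => 1) measurable_const
  rw [Qfun_self, ENNReal.ofReal_one, one_mul, lintegral_indicator_cyl] at hdb
  rw [hdb, ← lintegral_indicator_cyl, ← lintegral_const_mul' _ _ ENNReal.ofReal_ne_top]
  refine lintegral_mono fun σ => ?_
  by_cases hσ : σ ∈ cyl Λ τ
  · simp only [Set.indicator_of_mem hσ, mul_one]
    refine ENNReal.ofReal_le_ofReal (Real.exp_le_exp.2 ?_)
    have h1 := abs_le.1 (abs_energy_glue_sub_le β h Λ τ σ σ₀ η)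
    have h2 := abs_le.1 (abs_energy_glue_sub_le β h Λ τ' σ σ₀ η)
    rw [glue_eq_self hσ] at h1
    linarith [h1.1, h1.2, h2.1, h2.2]
  · simp only [Set.indicator_of_notMem hσ, mul_zero, le_refl]

/-- The two quenched states differ on `Λ` by at most a boundary factor. -/
theorem state_cyl_le_state_cyl (hβ : 0 ≤ β) (s s' : Bool) (η : Config d H₀)
    (Λ : Finset (Site d)) (τ : Λ → Bool) :
    (state β h s η : Measure (Config d Bool)) (cyl Λ τ) ≤
      ENNReal.ofReal (Real.exp (4 * boundaryConst β Λ)) *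
        (state β h s' η : Measure (Config d Bool)) (cyl Λ τ) := by
  set μ := (state β h s η : Measure (Config d Bool))
  set ν := (state β h s' η : Measure (Config d Bool))
  -- The cross product compares the odds of `τ` against `τ'` in both states. With the same exterior
  -- the energies cancel, leaving `2 + 2` boundary constants; summing over `τ'` removes the
  -- auxiliary cylinder.
  have hpair : ∀ τ' : Λ → Bool, μ (cyl Λ τ) * ν (cyl Λ τ') ≤
      ENNReal.ofReal (Real.exp (4 * boundaryConst β Λ)) * ν (cyl Λ τ) * μ (cyl Λ τ') := by
    intro τ'
    refine (mul_le_mul' (state_cyl_le_mul_state_cyl β h hβ s η Λ τ' τ fun _ => true)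
      (state_cyl_le_mul_state_cyl β h hβ s' η Λ τ τ' fun _ => true)).trans (le_of_eq ?_)
    rw [mul_mul_mul_comm, ← ENNReal.ofReal_mul (Real.exp_pos _).le, ← Real.exp_add,
      mul_comm (μ (cyl Λ τ')), ← mul_assoc]
    congr 4
    ring
  have hsum := Finset.sum_le_sum fun τ' (_ : τ' ∈ Finset.univ) => hpair τ'
  rwa [← Finset.mul_sum, ← Finset.mul_sum, sum_measure_cyl, sum_measure_cyl, mul_one,
    mul_one] at hsum

variable {P₀ : Measure H₀} [IsProbabilityMeasure P₀]

/-- The quenched bound is uniform in the fields and both joint measures have the same field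
marginal, so it integrates. -/
theorem jointMeasure_cyl_le (hβ : 0 ≤ β) (s s' : Bool) (Λ : Finset (Site d))
    (ζ : Λ → Bool × H₀) :
    jointMeasure β h P₀ s (cyl Λ ζ) ≤
      ENNReal.ofReal (Real.exp (4 * boundaryConst β Λ)) * jointMeasure β h P₀ s' (cyl Λ ζ) := by
  have hcyl : ∀ s, jointMeasure β h P₀ s (cyl Λ ζ) =
      ∫⁻ η, (cyl Λ fun x => (ζ x).2).indicator (fun η =>
        (state β h s η : Measure (Config d Bool)) (cyl Λ fun x => (ζ x).1)) η
        ∂(disorderLaw d P₀) := by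
    intro s
    rw [← lintegral_indicator_cyl, lintegral_jointMeasure β h P₀ hβ s
      (measurable_const.indicator (measurableSet_cylinder Λ ζ))]
    refine lintegral_congr fun η => ?_
    by_cases hη : η ∈ cyl Λ fun x => (ζ x).2
    · rw [Set.indicator_of_mem hη, ← lintegral_indicator_cyl]
      refine lintegral_congr fun σ => ?_
      by_cases hσ : σ ∈ cyl Λ fun x => (ζ x).1
      · rw [Set.indicator_of_mem hσ, Set.indicator_of_mem (join_mem_cyl.2 ⟨hσ, hη⟩)]
      · rw [Set.indicator_of_notMem hσ,
          Set.indicator_of_notMem fun hm => hσ (join_mem_cyl.1 hm).1]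
    · rw [Set.indicator_of_notMem hη]
      refine (lintegral_congr fun σ => ?_).trans lintegral_zero
      exact Set.indicator_of_notMem (fun hm => hη (join_mem_cyl.1 hm).2) _
  rw [hcyl, hcyl, ← lintegral_const_mul' _ _ ENNReal.ofReal_ne_top]
  refine lintegral_mono fun η => ?_
  by_cases hη : η ∈ cyl Λ fun x => (ζ x).2
  · simp only [Set.indicator_of_mem hη]
    exact state_cyl_le_state_cyl β h hβ s s' η Λ _
  · simp only [Set.indicator_of_notMem hη, mul_zero, le_refl]

theorem finiteRelEntropy_jointMeasure_le (hβ : 0 ≤ β) (s s' : Bool) (Λ : Finset (Site d)) :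
    finiteRelEntropy Λ (jointMeasure β h P₀ s) (jointMeasure β h P₀ s') ≤
      ENNReal.ofReal (4 * boundaryConst β Λ) := by
  have hprob := isProbabilityMeasure_jointMeasure (d := d) β h P₀ hβ s
  have hprob' := isProbabilityMeasure_jointMeasure (d := d) β h P₀ hβ s'
  have hm : Measurable fun (ξ : Config d (Bool × H₀)) (x : Λ) => ξ x :=
    measurable_pi_lambda _ fun x => measurable_pi_apply (x : Site d)
  have h1 := Measure.isProbabilityMeasure_map (μ := jointMeasure (d := d) β h P₀ s)
    hm.aemeasurable
  have h2 := Measure.isProbabilityMeasure_map (μ := jointMeasure (d := d) β h P₀ s')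
    hm.aemeasurable
  refine klDiv_le_of_forall_singleton_le _ _
    (mul_nonneg zero_le_four (boundaryConst_nonneg β Λ)) fun ζ => ?_
  rw [Measure.map_apply hm (measurableSet_singleton ζ),
    Measure.map_apply hm (measurableSet_singleton ζ)]
  have hset : (fun (ξ : Config d (Bool × H₀)) (x : Λ) => ξ x) ⁻¹' {ζ} = cyl Λ ζ := by
    ext ξ
    exact mem_cyl_iff.symm
  rw [hset]
  exact jointMeasure_cyl_le β h hβ s s' Λ ζ

/-- A boundary bond in direction `i` is fixed by its other coordinates, which range over the cube,
and by one of two values of coordinate `i`. Multiplying by the side length avoids the exponent `d -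
1`. -/
theorem card_boundaryBonds_cube_mul_le (d n : ℕ) (i : Fin d) :
    (boundaryBonds (cube d n) i).card * (2 * n + 1) ≤ 2 * (cube d n).card := by
  classical
  -- Base points are lower endpoints: a bond leaving the cube starts at `n`, one entering it starts
  -- at `-n - 1`, just outside.
  let T : Fin d → Finset ℤ := fun j =>
    if j = i then {(n : ℤ), -(n : ℤ) - 1} else Finset.Icc (-(n : ℤ)) n
  have hIcc : (Finset.Icc (-(n : ℤ)) n).card = 2 * n + 1 := by
    rw [Int.card_Icc]; omega
  have hsub : boundaryBonds (cube d n) i ⊆ Fintype.piFinset T := by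
    intro x hx
    rw [boundaryBonds, Finset.mem_filter, mem_bonds] at hx
    simp only [cube, Fintype.mem_piFinset, Finset.mem_Icc, Pi.add_apply] at hx
    obtain ⟨hor, hnot⟩ := hx
    have hoff : ∀ j, j ≠ i → -(n : ℤ) ≤ x j ∧ x j ≤ n := by
      intro j hj
      rcases hor with h1 | h1
      · exact h1 j
      · simpa [Pi.single_eq_of_ne hj] using h1 j
    rw [Fintype.mem_piFinset]
    intro j
    by_cases hj : j = i
    · subst hj
      simp only [T, if_true, Finset.mem_insert, Finset.mem_singleton]
      by_contra hne
      rw [not_or] at hne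
      refine hnot ⟨fun k => ?_, fun k => ?_⟩
      · by_cases hk : k = j
        · subst hk
          rcases hor with h1 | h1
          · exact h1 k
          · have := h1 k
            rw [Pi.single_eq_same] at this
            omega
        · exact hoff k hk
      · by_cases hk : k = j
        · subst hk
          rw [Pi.single_eq_same]
          rcases hor with h1 | h1
          · have := h1 k
            omega
          · have := h1 k
            rwa [Pi.single_eq_same] at this
        · simpa [Pi.single_eq_of_ne hk] using hoff k hk
    · simp only [T, if_neg hj, Finset.mem_Icc]
      exact hoff j hj
  have hT : (Fintype.piFinset T).card * (2 * n + 1) ≤ 2 * (cube d n).card := by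
    rw [Fintype.card_piFinset, cube, Fintype.card_piFinset,
      ← Finset.mul_prod_erase _ (fun j => (T j).card) (Finset.mem_univ i),
      ← Finset.mul_prod_erase _ (fun _ : Fin d => (Finset.Icc (-(n : ℤ)) n).card)
        (Finset.mem_univ i)]
    have hother : ∏ j ∈ Finset.univ.erase i, (T j).card =
        ∏ j ∈ Finset.univ.erase i, (Finset.Icc (-(n : ℤ)) n).card :=
      Finset.prod_congr rfl fun j hj => by simp only [T, if_neg (Finset.ne_of_mem_erase hj)]
    have hi : (T i).card ≤ 2 := by simpa only [T, if_true] using Finset.card_le_two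
    rw [hother, hIcc, mul_assoc, mul_comm (2 * n + 1)]
    exact Nat.mul_le_mul_right _ hi
  exact (Nat.mul_le_mul_right _ (Finset.card_le_card hsub)).trans hT

/-- The constant is `16 = 4 * 2 * 2`: from the entropy bound, from `boundaryConst`, and from the two
faces in each of the `d` directions. -/
theorem boundaryConst_cube_div_le (d n : ℕ) :
    4 * boundaryConst β (cube d n) / (cube d n).card ≤ 16 * |β| * d / (2 * n + 1) := by
  have hcard : 0 < ((cube d n).card : ℝ) := by
    refine Nat.cast_pos.2 (Finset.card_pos.2 ⟨0, ?_⟩)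
    simp [cube]
  have hn : (0 : ℝ) < 2 * n + 1 := by positivity
  rw [div_le_div_iff₀ hcard hn, boundaryConst]
  have hsum : (∑ i : Fin d, ((boundaryBonds (cube d n) i).card : ℝ)) * (2 * n + 1) ≤
      d * (2 * (cube d n).card) := by
    rw [Finset.sum_mul]
    refine (Finset.sum_le_sum (g := fun _ => 2 * ((cube d n).card : ℝ)) fun i _ => ?_).trans
      (le_of_eq ?_)
    · exact_mod_cast card_boundaryBonds_cube_mul_le d n i
    · rw [Finset.sum_const, Finset.card_univ, Fintype.card_fin, nsmul_eq_mul]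
  have := mul_le_mul_of_nonneg_left hsum (mul_nonneg (by norm_num : (0 : ℝ) ≤ 8) (abs_nonneg β))
  linarith

theorem hasRelEntropyDensity_jointMeasure (hβ : 0 ≤ β) (s s' : Bool) :
    HasRelEntropyDensity (jointMeasure (d := d) β h P₀ s) (jointMeasure β h P₀ s') 0 := by
  have hlim : Tendsto (fun n : ℕ => ENNReal.ofReal (16 * |β| * d / (2 * n + 1))) atTop (𝓝 0) := by
    rw [← ENNReal.ofReal_zero]
    refine ENNReal.tendsto_ofReal (Tendsto.div_atTop tendsto_const_nhds ?_)
    exact tendsto_atTop_add_const_right _ _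
      (tendsto_natCast_atTop_atTop.const_mul_atTop zero_lt_two)
  refine tendsto_of_tendsto_of_tendsto_of_le_of_le tendsto_const_nhds hlim
    (fun _ => zero_le) fun n => ?_
  have hcard : 0 < ((cube d n).card : ℝ) := by
    refine Nat.cast_pos.2 (Finset.card_pos.2 ⟨0, ?_⟩)
    simp [cube]
  calc finiteRelEntropy (cube d n) (jointMeasure β h P₀ s) (jointMeasure β h P₀ s') /
        ((cube d n).card : ℝ≥0∞)
      ≤ ENNReal.ofReal (4 * boundaryConst β (cube d n)) / ((cube d n).card : ℝ≥0∞) :=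
        ENNReal.div_le_div_right (finiteRelEntropy_jointMeasure_le β h hβ s s' _) _
    _ = ENNReal.ofReal (4 * boundaryConst β (cube d n) / (cube d n).card) := by
        rw [ENNReal.ofReal_div_of_pos hcard, ENNReal.ofReal_natCast]
    _ ≤ _ := ENNReal.ofReal_le_ofReal (boundaryConst_cube_div_le β d n)

end Entropy

end RandomField

/-! ### The proposition. -/

open RandomField

theorem proposition6p15 (d : ℕ) (β h : ℝ) (hβ : 0 ≤ β) (hh : h ≠ 0)
    (H₀ : Finset ℝ) (P₀ : Measure H₀) [IsProbabilityMeasure P₀]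
    (hsupp : ∀ a : H₀, P₀ {a} ≠ 0)
    (hsymm : (P₀.map Subtype.val).map (fun a : ℝ => -a) = P₀.map Subtype.val)
    (hrandom : ∃ a ∈ H₀, a ≠ 0)
    (hphase : ∀ᵐ η ∂(disorderLaw d P₀), ∃ x : Site d,
      (state β h false η : Measure (Config d Bool)) {σ | σ x = true} <
        (state β h true η : Measure (Config d Bool)) {σ | σ x = true}) :
    -- the quenched plus and minus states exist as limits, for every realization of the fields
    (∀ (s : Bool) (η : Config d H₀),
      Tendsto (fun Λ : Finset (Site d) => quenched β h (fun _ => s) Λ η) atTop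
        (𝓝 (state β h s η))) ∧
    -- `γ^±` are nonnull translation-invariant specifications, and `K^± ∈ G_inv(γ^±)`
    (∀ s : Bool,
      IsSpecification (jointSpec (d := d) β h P₀ s) ∧
      IsNonnull (jointSpec (d := d) β h P₀ s) ∧
      IsTranslationInvariant (jointSpec (d := d) β h P₀ s) ∧
      HasFiniteSpinRange (jointSpec (d := d) β h P₀ s) ∧
      jointMeasure β h P₀ s ∈ invConsistentMeasures (jointSpec (d := d) β h P₀ s)) ∧
    -- `K^+` is not consistent with `γ^-` and `K^-` is not consistent with `γ^+`
    (∀ s : Bool,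
      jointMeasure β h P₀ (!s) ∉ consistentMeasures (jointSpec (d := d) β h P₀ s)) ∧
    -- no specification of finite range in the spins is shared by `K^+` and `K^-`
    (∀ γ : KernelFamily d (Bool × H₀), IsSpecification γ → HasFiniteSpinRange γ →
      ¬ (jointMeasure β h P₀ true ∈ consistentMeasures γ ∧
        jointMeasure β h P₀ false ∈ consistentMeasures γ)) ∧
    -- `h(K^+ | K^-) = h(K^- | K^+) = 0`, and the second part of the variational principle fails
    (∀ s : Bool,
      HasRelEntropyDensity (jointMeasure (d := d) β h P₀ (!s)) (jointMeasure β h P₀ s) 0 ∧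
      ∀ M : Set (Measure (Config d (Bool × H₀))),
        M ⊆ invariantMeasures d (Bool × H₀) → jointMeasure β h P₀ (!s) ∈ M →
          ¬ SecondPart (jointSpec β h P₀ s) (jointMeasure β h P₀ s) M) := by
  have hP : ∀ a : H₀, 0 < P₀.real {a} := fun a =>
    ENNReal.toReal_pos (hsupp a) (measure_ne_top _ _)
  obtain ⟨a, ha, ha0⟩ := hrandom
  let a₀ : H₀ := ⟨a, ha⟩
  have : Nonempty H₀ := ⟨a₀⟩
  -- Symmetry forces the reflection of a nonzero charged value to be charged as well, which provides
  -- the two field values needed to read the magnetization off `Qfun`.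
  have : Nontrivial H₀ := by
    have hneg : -a ∈ H₀ := by
      by_contra hna
      have hm : Measurable fun b : ℝ => -b := measurable_neg
      have h1 := Measure.ext_iff.1 hsymm {-a} (measurableSet_singleton _)
      rw [Measure.map_apply hm (measurableSet_singleton _),
        Measure.map_apply measurable_subtype_coe (hm (measurableSet_singleton _)),
        Measure.map_apply measurable_subtype_coe (measurableSet_singleton _)] at h1
      have h2 : (Subtype.val ⁻¹' {-a} : Set H₀) = ∅ := by
        ext b
        simp only [Set.mem_preimage, Set.mem_singleton_iff, Set.mem_empty_iff_false, iff_false]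
        exact fun hb => hna (hb ▸ b.2)
      rw [h2, measure_empty] at h1
      refine hsupp a₀ (measure_mono_null ?_ h1)
      rintro _ rfl
      simp [a₀]
    refine ⟨a₀, ⟨-a, hneg⟩, fun heq => ha0 ?_⟩
    have : a = -a := congrArg Subtype.val heq
    linarith
  have hinv : ∀ s : Bool, jointMeasure (d := d) β h P₀ s ∈
      invariantMeasures d (Bool × H₀) := fun s =>
    ⟨isProbabilityMeasure_jointMeasure β h P₀ hβ s, jointMeasure_map_shift β h P₀ hβ s⟩
  have hcons : ∀ s : Bool, jointMeasure (d := d) β h P₀ s ∈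
      consistentMeasures (jointSpec β h P₀ s) := fun s =>
    jointMeasure_mem_consistentMeasures β h hβ hP a₀ s
  have hboth := fun γ hγ => not_consistent_both (γ := γ) β h hβ hh hP hphase hγ
  -- Since `jointSpec` itself has finite range in the spins and is consistent with its own joint
  -- measure, this is a case of `hboth`.
  have hnot : ∀ s : Bool,
      jointMeasure β h P₀ (!s) ∉ consistentMeasures (jointSpec (d := d) β h P₀ s) := by
    intro s hs
    have hr := hasFiniteSpinRange_jointSpec (d := d) β h hβ hP a₀ s
    cases s
    · exact hboth _ hr ⟨hs, hcons false⟩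
    · exact hboth _ hr ⟨hcons true, hs⟩
  refine ⟨fun s η => tendsto_state β h hβ s η, fun s => ⟨?_, ?_, ?_,
    hasFiniteSpinRange_jointSpec β h hβ hP a₀ s, hcons s, hinv s⟩, hnot,
    fun γ _ hγ => hboth γ hγ, fun s => ⟨hasRelEntropyDensity_jointMeasure β h hβ _ _,
      fun M _ hM hsecond => ?_⟩⟩
  · rw [jointSpec_eq_gibbsKernel β h hβ hP a₀]
    exact isSpecification_gibbsKernel (jointWeight_pos β h hP a₀ s)
      (measurable_jointWeight β h hβ a₀ s) (isCompatible_jointWeight β h hβ a₀ s)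
  · rw [jointSpec_eq_gibbsKernel β h hβ hP a₀]
    exact isNonnull_gibbsKernel (jointWeight_pos β h hP a₀ s)
      (exists_jointWeight_le β h hP a₀ s)
  · rw [jointSpec_eq_gibbsKernel β h hβ hP a₀]
    exact isTranslationInvariant_gibbsKernel (jointWeight_image_add β h hβ a₀ s)
  · exact hnot s (hsecond _ hM (hasRelEntropyDensity_jointMeasure β h hβ _ _)).1
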